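/- Let $\alpha\in[1,2)$, $T>0$, $\mathbb T=\mathbb R/2\pi\mathbb Z$ (the unit circle with arc length), $\Omega=\mathbb T\times(0,1)$ with points $z=(\theta,r)$ and $dz=d\theta\,dr$, $\Gamma=\mathbb T\times\{1\}$, $\Gamma^*=\mathbb T\times\{0\}$, $w=r^\alpha$ and $A=\operatorname{diag}(1,r^\alpha)$. All functions are real-valued and gradients are taken in the sense of distributions on $\Omega$. Let $H^1(\Omega;w)=\{u\in L^2(\Omega):\int_\Omega\nabla u\cdot A\nabla u\,dz<\infty\}$, with inner product $\int_\Omega(uv+\nabla u\cdot A\nabla v)\,dz$. Let $H^1_\Gamma(\Omega;w)$ be the closure in $H^1(\Omega;w)$ of the set of functions in $C^\infty(\overline\Omega)$ whose support has positive distance to $\Gamma$, and let $H^{-1}_\Gamma(\Omega;w)$ be its dual with pivot space $L^2(\Omega)$. On $H^1_\Gamma(\Omega;w)$ write $(u,v)_{H^1_\Gamma}=\int_\Omega\nabla u\cdot A\nabla v\,dz$. Let $\mathcal Au=-\operatorname{div}(A\nabla u)$ and $D(\mathcal A)=\{u\in H^1_\Gamma(\Omega;w):\mathcal Au\in L^2(\Omega)\}$.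 Consider the problem $$\partial_{tt}\varphi-\operatorname{div}(A\nabla\varphi)=f\ \text{in }\Omega\times(0,T),\qquad \varphi=0\ \text{on }\Gamma\times(0,T),\qquad \tfrac{\partial\varphi}{\partial\nu_A}=0\ \text{on }\Gamma^*\times(0,T),\qquad \varphi(0)=\varphi^0,\ \partial_t\varphi(0)=\varphi^1\ \text{in }\Omega. \tag{1.1}$$ For $\varphi^0\in H^1_\Gamma(\Omega;w)$, $\varphi^1\in L^2(\Omega)$ and $f\in L^2(\Omega\times(0,T))$, a weak solution of (1.1) is a function $\varphi\in L^2(0,T;H^1_\Gamma(\Omega;w))\cap H^1(0,T;L^2(\Omega))\cap H^2(0,T;H^{-1}_\Gamma(\Omega;w))$ such that for each $v\in H^1_\Gamma(\Omega;w)$ one has $\langle\partial_{tt}\varphi,v\rangle_{H^{-1}_\Gamma,H^1_\Gamma}+(\varphi,v)_{H^1_\Gamma}=(f,v)_{L^2(\Omega)}$ for a.e. $t\in(0,T)$, and such that $\varphi(0)=\varphi^0$ and $\partial_t\varphi(0)=\varphi^1$, where $\varphi$ and $\partial_t\varphi$ are evaluated at $t=0$ through their continuous representatives with values in $L^2(\Omega)$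 and $H^{-1}_\Gamma(\Omega;w)$, respectively. **Corollary 2.30.** Let $\varphi^0\in D(\mathcal A)$, $\varphi^1\in H^1_\Gamma(\Omega;w)$ and $f=0$, and let $\varphi$ be the weak solution of (1.1) with respect to $(\varphi^0,\varphi^1,0)$. Then, after modification on a null set of times, $\varphi\in C([0,T];H^1_\Gamma(\Omega;w))\cap C^1([0,T];L^2(\Omega))$ with $\varphi(0)=\varphi^0$ and $\partial_t\varphi(0)=\varphi^1$, and for this representative $$E(t)=E(0)\quad\text{for each }t\in[0,T],\qquad\text{where } E(t)=\frac12\int_\Omega\big[(\partial_t\varphi)^2+\nabla\varphi\cdot A\nabla\varphi\big]\,dz .$$ -/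

import Mathlib

open MeasureTheory Set Filter Topology
open scoped ContDiff

noncomputable section

namespace DegenerateWave

instance fact_two_pi_pos : Fact (0 < 2 * Real.pi) := ⟨Real.two_pi_pos⟩

/-- The unit circle `𝕋`, parametrised by the angle `θ`, times the real line; points are
`z = (θ, r)`. The measure on the circle factor is arc length, of total mass `2π`. -/
abbrev Cyl : Type := AddCircle (2 * Real.pi) × ℝ

/-- The domain `Ω = 𝕋 × (0, 1)`. -/
def Omega : Set Cyl := univ ×ˢ Ioo (0 : ℝ) 1

/-- The measure `dz = dθ dr` on `Ω`. -/
def muOmega : Measure Cyl := volume.restrict Omega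

/-- The Lebesgue space `L²(Ω)` of real functions. -/
abbrev L2 : Type := Lp ℝ 2 muOmega

/-! ### Smooth functions on the cylinder -/

/-- `u` is a `C^∞` function on `𝕋 × ℝ`: it is smooth in the coordinates `(θ, r)`. -/
def SmoothCyl (u : Cyl → ℝ) : Prop :=
  ContDiff ℝ ∞ (fun p : ℝ × ℝ => u ((p.1 : AddCircle (2 * Real.pi)), p.2))

/-- The classical partial derivative `∂_θ u`. -/
def dTheta (u : Cyl → ℝ) (z : Cyl) : ℝ :=
  deriv (fun s : ℝ => u (z.1 + (s : AddCircle (2 * Real.pi)), z.2)) 0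

/-- The classical partial derivative `∂_r u`. -/
def dRad (u : Cyl → ℝ) (z : Cyl) : ℝ :=
  deriv (fun s : ℝ => u (z.1, s)) z.2

/-- The test functions `C_c^∞(Ω)`. -/
structure IsTest (ψ : Cyl → ℝ) : Prop where
  smooth : SmoothCyl ψ
  compact : HasCompactSupport ψ
  support : tsupport ψ ⊆ Omega

/-- `C_Γ^∞(Ω)`: functions smooth up to the boundary of `Ω` (restrictions of smooth functions on
`𝕋 × ℝ`), whose support in the closure of `Ω` has positive distance to `Γ = 𝕋 × {1}`. Only the
values on the closure of `Ω` matter. -/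
def IsSmoothGamma (ψ : Cyl → ℝ) : Prop :=
  SmoothCyl ψ ∧ ∃ δ > 0, ∀ z : Cyl, z.2 ∈ Icc (0 : ℝ) 1 → 1 - δ < z.2 → ψ z = 0

/-- `(p, q)` is the distributional gradient `(∂_θ u, ∂_r u)` of `u` in `Ω`. -/
structure IsWeakGrad (u p q : Cyl → ℝ) : Prop where
  theta : ∀ ψ, IsTest ψ → ∫ z, u z * dTheta ψ z ∂muOmega = -∫ z, p z * ψ z ∂muOmega
  rad : ∀ ψ, IsTest ψ → ∫ z, u z * dRad ψ z ∂muOmega = -∫ z, q z * ψ z ∂muOmega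

/-! ### Auxiliary facts: continuity and integrability -/

lemma isOpenQuotientMap_proj :
    IsOpenQuotientMap (fun p : ℝ × ℝ => (((p.1 : AddCircle (2 * Real.pi)), p.2) : Cyl)) :=
  IsOpenQuotientMap.prodMap QuotientAddGroup.isOpenQuotientMap_mk IsOpenQuotientMap.id

lemma SmoothCyl.continuous {u : Cyl → ℝ} (hu : SmoothCyl u) : Continuous u :=
  isOpenQuotientMap_proj.continuous_comp_iff.1 (ContDiff.continuous hu)

lemma SmoothCyl.hasDerivAt_theta {u : Cyl → ℝ} (hu : SmoothCyl u) (p : ℝ × ℝ) :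
    HasDerivAt (fun s : ℝ => u ((p.1 : AddCircle (2 * Real.pi)) + (s : AddCircle (2 * Real.pi)),
        p.2))
      (fderiv ℝ (fun p : ℝ × ℝ => u ((p.1 : AddCircle (2 * Real.pi)), p.2)) p (1, 0)) 0 := by
  have h1 : HasFDerivAt (fun p : ℝ × ℝ => u ((p.1 : AddCircle (2 * Real.pi)), p.2))
      (fderiv ℝ (fun p : ℝ × ℝ => u ((p.1 : AddCircle (2 * Real.pi)), p.2)) p)
      ((fun s : ℝ => (p.1 + s, p.2)) 0) := by
    simpa using ((ContDiff.differentiable hu (by simp)) p).hasFDerivAt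
  have h2 : HasDerivAt (fun s : ℝ => (p.1 + s, p.2)) ((1 : ℝ), (0 : ℝ)) 0 :=
    ((hasDerivAt_id (0 : ℝ)).const_add p.1).prodMk (hasDerivAt_const _ _)
  have h3 := h1.comp_hasDerivAt (0 : ℝ) h2
  refine h3.congr_of_eventuallyEq (Eventually.of_forall fun s => ?_)
  simp [Function.comp]

lemma SmoothCyl.hasDerivAt_rad {u : Cyl → ℝ} (hu : SmoothCyl u) (p : ℝ × ℝ) :
    HasDerivAt (fun s : ℝ => u ((p.1 : AddCircle (2 * Real.pi)), s))
      (fderiv ℝ (fun p : ℝ × ℝ => u ((p.1 : AddCircle (2 * Real.pi)), p.2)) p (0, 1)) p.2 := by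
  have h1 : HasFDerivAt (fun p : ℝ × ℝ => u ((p.1 : AddCircle (2 * Real.pi)), p.2))
      (fderiv ℝ (fun p : ℝ × ℝ => u ((p.1 : AddCircle (2 * Real.pi)), p.2)) p)
      ((fun s : ℝ => (p.1, s)) p.2) :=
    ((ContDiff.differentiable hu (by simp)) p).hasFDerivAt
  have h2 : HasDerivAt (fun s : ℝ => (p.1, s)) ((0 : ℝ), (1 : ℝ)) p.2 :=
    (hasDerivAt_const _ _).prodMk (hasDerivAt_id _)
  exact h1.comp_hasDerivAt p.2 h2

lemma SmoothCyl.continuous_dTheta {u : Cyl → ℝ} (hu : SmoothCyl u) : Continuous (dTheta u) := by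
  refine isOpenQuotientMap_proj.continuous_comp_iff.1 ?_
  have h : (dTheta u ∘ fun p : ℝ × ℝ => (((p.1 : AddCircle (2 * Real.pi)), p.2) : Cyl)) =
      fun p => fderiv ℝ (fun p : ℝ × ℝ => u ((p.1 : AddCircle (2 * Real.pi)), p.2)) p (1, 0) := by
    funext p
    exact (hu.hasDerivAt_theta p).deriv
  rw [h]
  exact (ContDiff.continuous_fderiv hu (by simp)).clm_apply continuous_const

lemma SmoothCyl.continuous_dRad {u : Cyl → ℝ} (hu : SmoothCyl u) : Continuous (dRad u) := by
  refine isOpenQuotientMap_proj.continuous_comp_iff.1 ?_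
  have h : (dRad u ∘ fun p : ℝ × ℝ => (((p.1 : AddCircle (2 * Real.pi)), p.2) : Cyl)) =
      fun p => fderiv ℝ (fun p : ℝ × ℝ => u ((p.1 : AddCircle (2 * Real.pi)), p.2)) p (0, 1) := by
    funext p
    exact (hu.hasDerivAt_rad p).deriv
  rw [h]
  exact (ContDiff.continuous_fderiv hu (by simp)).clm_apply continuous_const

lemma measurableSet_Omega : MeasurableSet Omega :=
  MeasurableSet.univ.prod measurableSet_Ioo

instance isFiniteMeasure_muOmega : IsFiniteMeasure muOmega := by
  refine ⟨?_⟩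
  rw [muOmega, Measure.restrict_apply_univ, Omega, Measure.volume_eq_prod, Measure.prod_prod]
  simp [ENNReal.mul_lt_top_iff]

lemma integrable_mul_continuous (u : L2) {g : Cyl → ℝ} (hg : Continuous g) :
    Integrable (fun z => u z * g z) muOmega := by
  have hK : IsCompact ((univ : Set (AddCircle (2 * Real.pi))) ×ˢ Icc (0 : ℝ) 1) :=
    isCompact_univ.prod isCompact_Icc
  obtain ⟨C, hC⟩ := hK.exists_bound_of_continuousOn hg.continuousOn
  refine ((Lp.memLp u).integrable (by norm_num)).mul_bdd hg.aestronglyMeasurable (c := C) ?_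
  refine (ae_restrict_iff' measurableSet_Omega).2 (Eventually.of_forall fun z hz => hC z ?_)
  exact ⟨mem_univ _, Ioo_subset_Icc_self hz.2⟩

lemma integrable_mul_rpow_test (u : L2) (β : ℝ) {ψ : Cyl → ℝ} (hψ : IsTest ψ) :
    Integrable (fun z => (z.2 ^ β * u z) * ψ z) muOmega := by
  have hcont : ContinuousOn (fun z : Cyl => z.2 ^ β * ψ z) (tsupport ψ) := by
    refine ContinuousOn.mul ?_ hψ.smooth.continuous.continuousOn
    exact continuousOn_snd.rpow_const fun z hz => Or.inl (hψ.support hz).2.1.ne'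
  obtain ⟨C, hC⟩ := IsCompact.exists_bound_of_continuousOn hψ.compact hcont
  have hm : Measurable (fun z : Cyl => z.2 ^ β * ψ z) :=
    (measurable_snd.pow_const β).mul hψ.smooth.continuous.measurable
  have := ((Lp.memLp u).integrable (by norm_num : (1 : ENNReal) ≤ 2)).mul_bdd (c := max C 0)
    hm.aestronglyMeasurable (Eventually.of_forall fun z => ?_)
  · refine this.congr (Eventually.of_forall fun z => ?_)
    simp only []
    ring
  · by_cases hz : z ∈ tsupport ψ
    · exact (hC z hz).trans (le_max_left _ _)
    · simp [image_eq_zero_of_notMem_tsupport hz]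

lemma integral_add_mul {f g h φ : Cyl → ℝ} (hh : h =ᵐ[muOmega] fun z => f z + g z)
    (hf : Integrable (fun z => f z * φ z) muOmega)
    (hg : Integrable (fun z => g z * φ z) muOmega) :
    ∫ z, h z * φ z ∂muOmega = ∫ z, f z * φ z ∂muOmega + ∫ z, g z * φ z ∂muOmega := by
  rw [← integral_add hf hg]
  refine integral_congr_ae ?_
  filter_upwards [hh] with z hz
  rw [hz, add_mul]

lemma integral_smul_mul {f h φ : Cyl → ℝ} (c : ℝ) (hh : h =ᵐ[muOmega] fun z => c * f z) :
    ∫ z, h z * φ z ∂muOmega = c * ∫ z, f z * φ z ∂muOmega := by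
  rw [← integral_const_mul]
  refine integral_congr_ae ?_
  filter_upwards [hh] with z hz
  rw [hz, mul_assoc]

lemma integral_zero_mul {h φ : Cyl → ℝ} (hh : h =ᵐ[muOmega] fun _ => 0) :
    ∫ z, h z * φ z ∂muOmega = 0 := by
  rw [integral_congr_ae (g := fun _ => (0 : ℝ)), integral_zero]
  filter_upwards [hh] with z hz
  rw [hz, zero_mul]

/-! ### The weighted Sobolev spaces -/

/-- The Hilbert space `L²(Ω) × L²(Ω) × L²(Ω)`, in which a function `u` of the weighted Sobolev
space is recorded together with its weighted gradient `A^{1/2} ∇u`, that is, as the triple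
`(u, ∂_θ u, r^{α/2} ∂_r u)`. -/
abbrev Ambient : Type := WithLp 2 (L2 × WithLp 2 (L2 × L2))

/-- The component `u` of a triple `(u, ∂_θ u, r^{α/2} ∂_r u)`. -/
def fnOf (U : Ambient) : L2 := U.fst

/-- The component `∂_θ u` of a triple `(u, ∂_θ u, r^{α/2} ∂_r u)`. -/
def gradTheta (U : Ambient) : Cyl → ℝ := U.snd.fst

/-- The function `∂_r u` for a triple `(u, ∂_θ u, r^{α/2} ∂_r u)`. -/
def gradRad (α : ℝ) (U : Ambient) : Cyl → ℝ := fun z => z.2 ^ (-(α / 2)) * U.snd.snd z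

lemma gradRad_add (α : ℝ) (U V : Ambient) :
    gradRad α (U + V) =ᵐ[muOmega] fun z => gradRad α U z + gradRad α V z := by
  have h : (U + V).snd.snd = U.snd.snd + V.snd.snd := rfl
  filter_upwards [Lp.coeFn_add U.snd.snd V.snd.snd] with z hz
  simp only [gradRad, h, hz, Pi.add_apply]
  ring

lemma gradRad_smul (α c : ℝ) (U : Ambient) :
    gradRad α (c • U) =ᵐ[muOmega] fun z => c * gradRad α U z := by
  have h : (c • U).snd.snd = c • U.snd.snd := rfl
  filter_upwards [Lp.coeFn_smul c U.snd.snd] with z hz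
  simp only [gradRad, h, hz, Pi.smul_apply, smul_eq_mul]
  ring

/-- The weighted space `H¹(Ω; w)`, `w = r^α`: the functions `u ∈ L²(Ω)` with a distributional
gradient such that `∫_Ω ∇u · A∇u dz = ∫_Ω (∂_θ u)² + r^α (∂_r u)² dz < ∞`. The inner product
inherited from the ambient space is `∫_Ω (u v + ∇u · A∇v) dz`. -/
def H1 (α : ℝ) : Submodule ℝ Ambient where
  carrier := {U | IsWeakGrad (fnOf U) (gradTheta U) (gradRad α U)}
  add_mem' := by
    intro U V hU hV
    have h1 : fnOf (U + V) =ᵐ[muOmega] fun z => fnOf U z + fnOf V z := Lp.coeFn_add _ _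
    have h2 : gradTheta (U + V) =ᵐ[muOmega] fun z => gradTheta U z + gradTheta V z :=
      Lp.coeFn_add _ _
    refine ⟨fun ψ hψ => ?_, fun ψ hψ => ?_⟩
    · rw [integral_add_mul h1 (integrable_mul_continuous _ hψ.smooth.continuous_dTheta)
          (integrable_mul_continuous _ hψ.smooth.continuous_dTheta),
        integral_add_mul h2 (integrable_mul_continuous _ hψ.smooth.continuous)
          (integrable_mul_continuous _ hψ.smooth.continuous), hU.theta ψ hψ, hV.theta ψ hψ]
      ring
    · rw [integral_add_mul h1 (integrable_mul_continuous _ hψ.smooth.continuous_dRad)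
          (integrable_mul_continuous _ hψ.smooth.continuous_dRad),
        integral_add_mul (gradRad_add α U V) (integrable_mul_rpow_test _ _ hψ)
          (integrable_mul_rpow_test _ _ hψ), hU.rad ψ hψ, hV.rad ψ hψ]
      ring
  zero_mem' := by
    have h1 : fnOf 0 =ᵐ[muOmega] fun _ => (0 : ℝ) := Lp.coeFn_zero _ _ _
    have h2 : gradTheta 0 =ᵐ[muOmega] fun _ => (0 : ℝ) := Lp.coeFn_zero _ _ _
    have h3 : gradRad α 0 =ᵐ[muOmega] fun _ => (0 : ℝ) := by
      have h := gradRad_smul α 0 0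
      simpa using h
    refine ⟨fun ψ _ => ?_, fun ψ _ => ?_⟩
    · rw [integral_zero_mul h1, integral_zero_mul h2, neg_zero]
    · rw [integral_zero_mul h1, integral_zero_mul h3, neg_zero]
  smul_mem' := by
    intro c U hU
    have h1 : fnOf (c • U) =ᵐ[muOmega] fun z => c * fnOf U z := Lp.coeFn_smul _ _
    have h2 : gradTheta (c • U) =ᵐ[muOmega] fun z => c * gradTheta U z := Lp.coeFn_smul _ _
    refine ⟨fun ψ hψ => ?_, fun ψ hψ => ?_⟩
    · rw [integral_smul_mul c h1, integral_smul_mul c h2, hU.theta ψ hψ]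
      ring
    · rw [integral_smul_mul c h1, integral_smul_mul c (gradRad_smul α c U), hU.rad ψ hψ]
      ring

/-- The subspace `C_Γ^∞(Ω)` of `H¹(Ω; w)`. -/
def smoothGamma (α : ℝ) : Submodule ℝ (H1 α) where
  carrier := {U | ∃ ψ, IsSmoothGamma ψ ∧ fnOf U =ᵐ[muOmega] ψ}
  add_mem' := by
    rintro U V ⟨ψ, ⟨hψ, δ, hδ, h0⟩, hU⟩ ⟨χ, ⟨hχ, ε, hε, k0⟩, hV⟩
    refine ⟨fun z => ψ z + χ z, ⟨ContDiff.add hψ hχ, min δ ε, lt_min hδ hε, fun z hz hz' => ?_⟩, ?_⟩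
    · change ψ z + χ z = 0
      rw [h0 z hz (by linarith [min_le_left δ ε]), k0 z hz (by linarith [min_le_right δ ε]),
        add_zero]
    · have h1 : fnOf (U + V : H1 α) =ᵐ[muOmega] fun z => fnOf U z + fnOf V z := Lp.coeFn_add _ _
      filter_upwards [h1, hU, hV] with z hz hz1 hz2
      rw [hz, hz1, hz2]
  zero_mem' :=
    ⟨fun _ => 0, ⟨contDiff_const, 1, one_pos, fun _ _ _ => rfl⟩, Lp.coeFn_zero _ _ _⟩
  smul_mem' := by
    rintro c U ⟨ψ, ⟨hψ, δ, hδ, h0⟩, hU⟩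
    refine ⟨fun z => c * ψ z, ⟨ContDiff.mul contDiff_const hψ, δ, hδ, fun z hz hz' => ?_⟩, ?_⟩
    · change c * ψ z = 0
      rw [h0 z hz hz', mul_zero]
    · have h1 : fnOf (c • U : H1 α) =ᵐ[muOmega] fun z => c * fnOf U z := Lp.coeFn_smul _ _
      filter_upwards [h1, hU] with z hz hz1
      rw [hz, hz1]

/-- The space `H¹_Γ(Ω; w)`: the closure of `C_Γ^∞(Ω)` in `H¹(Ω; w)`. -/
def H1Gamma (α : ℝ) : Submodule ℝ (H1 α) := (smoothGamma α).topologicalClosure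

/-- The inclusion of `H¹_Γ(Ω; w)` into `L²(Ω)`. -/
def toL2 (α : ℝ) : H1Gamma α →L[ℝ] L2 :=
  (WithLp.fstL 2 ℝ L2 (WithLp 2 (L2 × L2))).comp ((H1 α).subtypeL.comp (H1Gamma α).subtypeL)

/-- The function `∇u · A∇v = ∂_θ u ∂_θ v + r^α ∂_r u ∂_r v`, where `A = diag(1, r^α)`. -/
def gradDot (α : ℝ) (U V : Ambient) (z : Cyl) : ℝ :=
  gradTheta U z * gradTheta V z + z.2 ^ α * (gradRad α U z * gradRad α V z)

/-- The inner product `(u, v)_{H¹_Γ(Ω; w)} = ∫_Ω ∇u · A∇v dz`. -/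
def gradForm (α : ℝ) (u v : H1Gamma α) : ℝ := ∫ z, gradDot α u v z ∂muOmega

/-- `u ∈ D(𝒜) = H¹_Γ(Ω; w) ∩ H²(Ω; w)`: the distribution `𝒜u = -div(A∇u)` on `Ω` is a function
`g ∈ L²(Ω)`. -/
def InDomain (α : ℝ) (u : H1Gamma α) : Prop :=
  ∃ g : L2, ∀ ψ, IsTest ψ →
    ∫ z, (gradTheta u z * dTheta ψ z + z.2 ^ α * gradRad α u z * dRad ψ z) ∂muOmega =
      ∫ z, g z * ψ z ∂muOmega

/-- The dual space `H_Γ^{-1}(Ω; w)` of `H¹_Γ(Ω; w)`. -/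
abbrev Hneg (α : ℝ) : Type := StrongDual ℝ (H1Gamma α)

/-- With `L²(Ω)` as pivot space, `g ∈ L²(Ω)` acts on `H¹_Γ(Ω; w)` by `v ↦ (g, v)_{L²(Ω)}`. -/
def pivot (α : ℝ) (g : L2) : Hneg α := (innerSL ℝ g).comp (toL2 α)

/-! ### Weak solutions -/

/-- `v` is the weak (distributional) time derivative of `u` on `(0, T)`, for functions with values
in a normed space. -/
def HasWeakTimeDeriv {X : Type*} [NormedAddCommGroup X] [NormedSpace ℝ X] (T : ℝ)
    (u v : ℝ → X) : Prop :=
  ∀ η : ℝ → ℝ, ContDiff ℝ ∞ η → HasCompactSupport η → tsupport η ⊆ Ioo 0 T →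
    ∫ t in Ioo 0 T, deriv η t • u t = -∫ t in Ioo 0 T, η t • v t

/-- `u`, which is determined up to null sets of times, has a representative that is continuous on
`[0, T]` and takes the value `u₀` at `t = 0`. -/
def HasInitialValue {X : Type*} [NormedAddCommGroup X] (T : ℝ) (u : ℝ → X) (u₀ : X) : Prop :=
  ∃ c : ℝ → X, ContinuousOn c (Icc 0 T) ∧ c =ᵐ[volume.restrict (Ioo 0 T)] u ∧ c 0 = u₀

/-- `φ` is a weak solution on `Ω × (0, T)` of the problem
`∂_tt φ - div(A∇φ) = f`, `φ = 0` on `Γ × (0, T)`, `∂φ/∂ν_A = 0` on `Γ* × (0, T)`,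
`φ(0) = φ₀`, `∂_t φ(0) = φ₁`, where `f ∈ L²(Q) = L²(0, T; L²(Ω))`: the function `φ` belongs to
`L²(0, T; H¹_Γ(Ω; w)) ∩ H¹(0, T; L²(Ω)) ∩ H²(0, T; H_Γ^{-1}(Ω; w))` with weak derivatives
`∂_t φ = φt` and `∂_tt φ = φtt`, and satisfies the equation and the initial conditions. -/
def IsWeakSolution (α T : ℝ) (φ₀ : H1Gamma α) (φ₁ : L2) (f : ℝ → L2) (φ : ℝ → H1Gamma α) : Prop :=
  MemLp φ 2 (volume.restrict (Ioo 0 T)) ∧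
  ∃ (φt : ℝ → L2) (φtt : ℝ → Hneg α),
    MemLp φt 2 (volume.restrict (Ioo 0 T)) ∧
    MemLp φtt 2 (volume.restrict (Ioo 0 T)) ∧
    HasWeakTimeDeriv T (fun t => toL2 α (φ t)) φt ∧
    HasWeakTimeDeriv T (fun t => pivot α (φt t)) φtt ∧
    (∀ v : H1Gamma α, ∀ᵐ t ∂(volume.restrict (Ioo 0 T)),
      φtt t v + gradForm α (φ t) v = inner ℝ (f t) (toL2 α v)) ∧
    HasInitialValue T (fun t => toL2 α (φ t)) (toL2 α φ₀) ∧
    HasInitialValue T (fun t => pivot α (φt t)) (pivot α φ₁)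

/-- The energy `½ ∫_Ω [v² + ∇u · A∇u] dz` of a state `u` with velocity `v`. -/
def energy (α : ℝ) (u : H1Gamma α) (v : L2) : ℝ :=
  1 / 2 * ∫ z, ((v z) ^ 2 + gradDot α u u z) ∂muOmega

end DegenerateWave

end

noncomputable section

namespace DegenerateWave

/-! ### Weak time derivatives -/

section WeakTimeDeriv

variable {X Y : Type*} [NormedAddCommGroup X] [NormedSpace ℝ X] [NormedAddCommGroup Y]
  [NormedSpace ℝ Y]

/-! Formally, pairing the equation with ∂_t φ gives E' = 0, but ∂_t φ takes values only in L²(Ω) and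
is not an admissible test function. The solution is therefore smoothed by operators that commute
with the equation.

Let V = H¹_Γ with its full inner product, H = L²(Ω), i : V → H the inclusion, and G = i* i, a
bounded self-adjoint injective operator on V. Put p = Gφ and q = i* ∂_t φ. The Riesz map, followed
by one further application of G, turns the weak formulation into p' = q, (Gq)' = Gp - p. All these
functions have continuous representatives in V, so the derivatives are classical
(`HasWeakTimeDeriv.hasDerivWithinAt`).

Resolvents of G provide bounded L_n that commute with G and satisfy L_n G² → 1 strongly
(`exists_tendsto_gram_gram`). For u_n = L_n G p and v_n = i L_n G q the formal computation is
legitimate: energy is conserved (`regularised_energy_eq`), and differences obey a Gronwall bound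
(`regularised_norm_le`). Since p(0) = Gφ⁰ and q(0) = Gφ¹, the initial values converge to the data;
hence (u_n, v_n) converges uniformly on [0, T] and the energy identity passes to the limit
(`exists_energy_solution`).

The concrete spaces have to supply completeness, injectivity of i (`toL2_injective`), and the
formula for the energy in terms of Hilbert norms (`energy_eq`). -/

lemma exists_Icc_of_isCompact_subset_Ioo {K : Set ℝ} {a b : ℝ} (hab : a < b) (hK : IsCompact K)
    (hKs : K ⊆ Ioo a b) : ∃ c d, a < c ∧ c ≤ d ∧ d < b ∧ K ⊆ Icc c d := by
  rcases K.eq_empty_or_nonempty with rfl | hne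
  · exact ⟨(a + b) / 2, (a + b) / 2, by linarith, le_rfl, by linarith, empty_subset _⟩
  · obtain ⟨c, hc⟩ := hK.exists_isLeast hne
    obtain ⟨d, hd⟩ := hK.exists_isGreatest hne
    exact ⟨c, d, (hKs hc.1).1, hc.2 hd.1, (hKs hd.1).2, fun x hx => ⟨hc.2 hx, hd.2 hx⟩⟩

/-- A test function on `(0, T)` of mean zero is the derivative of a test function. -/
lemma exists_test_deriv_eq {T : ℝ} (hT : 0 < T) {κ : ℝ → ℝ} (hκ : ContDiff ℝ ∞ κ)
    (hκc : HasCompactSupport κ) (hκs : tsupport κ ⊆ Ioo 0 T) (h0 : ∫ t in Ioo 0 T, κ t = 0) :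
    ∃ ζ : ℝ → ℝ, ContDiff ℝ ∞ ζ ∧ HasCompactSupport ζ ∧ tsupport ζ ⊆ Ioo 0 T ∧ deriv ζ = κ := by
  obtain ⟨a, b, ha, hab, hb, hK⟩ := exists_Icc_of_isCompact_subset_Ioo hT hκc hκs
  have hz : ∀ t, t ∉ Icc a b → κ t = 0 := fun t ht =>
    image_eq_zero_of_notMem_tsupport fun h => ht (hK h)
  have hd : ∀ t, HasDerivAt (fun t => ∫ s in (0 : ℝ)..t, κ s) (κ t) t := fun t =>
    intervalIntegral.integral_hasDerivAt_right (hκ.continuous.intervalIntegrable _ _)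
      (hκ.continuous.stronglyMeasurableAtFilter _ _) hκ.continuous.continuousAt
  have hderiv : deriv (fun t => ∫ s in (0 : ℝ)..t, κ s) = κ := funext fun t => (hd t).deriv
  have hT0 : ∫ s in (0 : ℝ)..T, κ s = 0 := by
    rw [intervalIntegral.integral_of_le hT.le, integral_Ioc_eq_integral_Ioo, h0]
  have hsupp : ∀ t, t ∉ Icc a b → ∫ s in (0 : ℝ)..t, κ s = 0 := by
    intro t ht
    rcases lt_or_ge t a with hta | hta
    · refine intervalIntegral.integral_zero_ae (Eventually.of_forall fun s hs => hz s ?_)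
      intro hs'
      have := hs.2
      have h2 : max 0 t < a := max_lt ha hta
      linarith [hs'.1]
    · have htb : b < t := by
        by_contra h
        exact ht ⟨hta, not_lt.1 h⟩
      -- To the right of the support the primitive equals its value at T, which vanishes by the
      -- mean-zero hypothesis.
      rw [← intervalIntegral.integral_add_adjacent_intervals (b := T)
        (hκ.continuous.intervalIntegrable _ _) (hκ.continuous.intervalIntegrable _ _), hT0,
        zero_add]
      refine intervalIntegral.integral_zero_ae (Eventually.of_forall fun s hs => hz s ?_)
      intro hs'
      have := hs.1
      have h2 : b < min T t := lt_min hb htb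
      linarith [hs'.2]
  have hts : tsupport (fun t => ∫ s in (0 : ℝ)..t, κ s) ⊆ Icc a b :=
    closure_minimal (fun t ht => by_contra fun h => ht (hsupp t h)) isClosed_Icc
  refine ⟨fun t => ∫ s in (0 : ℝ)..t, κ s, ?_, ?_, fun t ht => ?_, hderiv⟩
  · rw [contDiff_infty_iff_deriv, hderiv]
    exact ⟨fun t => (hd t).differentiableAt, hκ⟩
  · exact isCompact_Icc.of_isClosed_subset (isClosed_tsupport _) hts
  · exact ⟨ha.trans_le (hts ht).1, (hts ht).2.trans_lt hb⟩

lemma IntegrableOn.continuous_smul_of_hasCompactSupport {S : Set ℝ} {u : ℝ → X} {η : ℝ → ℝ}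
    (hu : IntegrableOn u S) (hη : Continuous η) (hηc : HasCompactSupport η) :
    IntegrableOn (fun t => η t • u t) S := by
  obtain ⟨C, hC⟩ := hηc.exists_bound_of_continuous hη
  exact hu.bdd_smul C hη.aestronglyMeasurable (Eventually.of_forall hC)

/-- Extending by the endpoint values makes two-sided calculus on the line available for functions
known only on the closed interval. -/
lemma exists_continuous_eqOn_Icc {Z : Type*} [TopologicalSpace Z] {a b : ℝ} (hab : a ≤ b)
    {g : ℝ → Z} (hg : ContinuousOn g (Icc a b)) : ∃ w, Continuous w ∧ EqOn w g (Icc a b) :=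
  ⟨IccExtend hab ((Icc a b).domRestrict g),
    (continuousOn_iff_continuous_domRestrict.1 hg).Icc_extend',
    fun s hs => by rw [IccExtend_of_mem _ _ hs, domRestrict_apply]⟩

/-- The lemma of du Bois-Reymond. -/
lemma ae_eq_const_of_integral_deriv_smul_eq_zero [CompleteSpace X] {T : ℝ} (hT : 0 < T) {h : ℝ → X}
    (hh : IntegrableOn h (Ioo 0 T))
    (h0 : ∀ η : ℝ → ℝ, ContDiff ℝ ∞ η → HasCompactSupport η → tsupport η ⊆ Ioo 0 T →
      ∫ t in Ioo 0 T, deriv η t • h t = 0) :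
    ∃ c : X, ∀ᵐ t ∂(volume.restrict (Ioo 0 T)), h t = c := by
  -- Any bump of integral one supported in (0, T) would do; its weighted mean of `h` is the constant
  -- sought.
  let g : ContDiffBump (T / 2) := ⟨T / 8, T / 4, by positivity, by linarith⟩
  let η₀ : ℝ → ℝ := g.normed volume
  have hη₀ : ContDiff ℝ ∞ η₀ := g.contDiff_normed
  have hη₀c : HasCompactSupport η₀ := g.hasCompactSupport_normed
  have hη₀s : tsupport η₀ ⊆ Ioo 0 T := by
    rw [g.tsupport_normed_eq, Real.closedBall_eq_Icc]
    intro t ht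
    have h1 : T / 2 - T / 4 ≤ t := ht.1
    have h2 : t ≤ T / 2 + T / 4 := ht.2
    exact ⟨by linarith, by linarith⟩
  have hη₀i : ∫ t in Ioo 0 T, η₀ t = 1 := by
    rw [setIntegral_eq_integral_of_forall_compl_eq_zero, g.integral_normed]
    exact fun t ht => image_eq_zero_of_notMem_tsupport fun h => ht (hη₀s h)
  have hint : ∀ η : ℝ → ℝ, Continuous η → HasCompactSupport η →
      IntegrableOn (fun t => η t • h t) (Ioo 0 T) := fun η hη hηc =>
    IntegrableOn.continuous_smul_of_hasCompactSupport hh hη hηc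
  refine ⟨∫ t in Ioo 0 T, η₀ t • h t, ?_⟩
  have key := isOpen_Ioo.ae_eq_zero_of_integral_contDiff_smul_eq_zero (μ := volume)
    (f := fun t => h t - ∫ t in Ioo 0 T, η₀ t • h t)
    ((hh.sub (integrableOn_const (by simp))).locallyIntegrableOn) ?_
  · rw [ae_restrict_iff' measurableSet_Ioo]
    filter_upwards [key] with t ht h
    exact sub_eq_zero.1 (ht h)
  intro η hη hηc hηs
  set m : ℝ := ∫ t in Ioo 0 T, η t with hm
  have hi1 : IntegrableOn η (Ioo 0 T) := (hη.continuous.integrable_of_hasCompactSupport hηc).integrableOn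
  have hi2 : IntegrableOn η₀ (Ioo 0 T) :=
    (hη₀.continuous.integrable_of_hasCompactSupport hη₀c).integrableOn
  have hm0 : ∫ t in Ioo 0 T, (η t - m * η₀ t) = 0 := by
    rw [integral_sub hi1 (hi2.const_mul m), integral_const_mul, hη₀i, hm, mul_one, sub_self]
  -- Subtracting m η₀ from η leaves a function of mean zero, which is then the derivative of a test
  -- function.
  obtain ⟨ζ, h1, h2, h3, h4⟩ := exists_test_deriv_eq hT (κ := fun t => η t - m * η₀ t)
    (hη.sub (contDiff_const.mul hη₀)) (hηc.sub hη₀c.mul_left)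
    ((tsupport_sub _ _).trans (union_subset hηs (tsupport_mul_subset_right.trans hη₀s))) hm0
  have := h0 ζ h1 h2 h3
  rw [h4] at this
  rw [← setIntegral_eq_integral_of_forall_compl_eq_zero (s := Ioo 0 T)]
  · simp only [smul_sub, sub_smul, mul_smul] at this ⊢
    rw [integral_sub (hint η hη.continuous hηc)
      (show Integrable (fun t => m • η₀ t • h t) _ from (hint η₀ hη₀.continuous hη₀c).smul m),
      integral_smul] at this
    rw [integral_sub (hint η hη.continuous hηc) (hi1.smul_const _), integral_smul_const]
    exact this
  · intro t ht
    rw [image_eq_zero_of_notMem_tsupport fun h => ht (hηs h), zero_smul]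

lemma hasDerivWithinAt_of_eq_add_integral [CompleteSpace X] {T : ℝ} {f g : ℝ → X}
    (hg : ContinuousOn g (Icc 0 T)) (hf : ∀ t ∈ Icc 0 T, f t = f 0 + ∫ s in (0 : ℝ)..t, g s)
    {t : ℝ} (ht : t ∈ Icc 0 T) : HasDerivWithinAt f (g t) (Icc 0 T) t := by
  obtain ⟨w, hc, he⟩ := exists_continuous_eqOn_Icc (ht.1.trans ht.2) hg
  have hd : HasDerivAt (fun t => f 0 + ∫ s in (0 : ℝ)..t, w s) (g t) t := by
    rw [← he ht]
    exact (intervalIntegral.integral_hasDerivAt_right (hc.intervalIntegrable _ _)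
      (hc.stronglyMeasurableAtFilter _ _) hc.continuousAt).const_add _
  have hcg : ∀ s ∈ Icc 0 T, f s = f 0 + ∫ r in (0 : ℝ)..s, w r := by
    intro s hs
    rw [hf s hs]
    congr 1
    refine intervalIntegral.integral_congr fun r hr => (he ?_).symm
    rw [uIcc_of_le hs.1] at hr
    exact ⟨hr.1, hr.2.trans hs.2⟩
  exact hd.hasDerivWithinAt.congr hcg (hcg t ht)

lemma HasWeakTimeDeriv.congr {T : ℝ} {u v u' v' : ℝ → X} (h : HasWeakTimeDeriv T u v)
    (hu : u' =ᵐ[volume.restrict (Ioo 0 T)] u) (hv : v' =ᵐ[volume.restrict (Ioo 0 T)] v) :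
    HasWeakTimeDeriv T u' v' := by
  intro η h1 h2 h3
  have e1 : ∫ t in Ioo 0 T, deriv η t • u' t = ∫ t in Ioo 0 T, deriv η t • u t :=
    integral_congr_ae (hu.mono fun t ht => by simp only [ht])
  have e2 : ∫ t in Ioo 0 T, η t • v' t = ∫ t in Ioo 0 T, η t • v t :=
    integral_congr_ae (hv.mono fun t ht => by simp only [ht])
  rw [e1, e2, h η h1 h2 h3]

/-- Bounded operators commute with Bochner integrals. Integrability is needed because the integral
of a non-integrable function is zero by convention. -/
lemma HasWeakTimeDeriv.map [CompleteSpace X] [CompleteSpace Y] {T : ℝ} {u v : ℝ → X}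
    (h : HasWeakTimeDeriv T u v) (hu : IntegrableOn u (Ioo 0 T)) (hv : IntegrableOn v (Ioo 0 T))
    (L : X →L[ℝ] Y) :
    HasWeakTimeDeriv T (fun t => L (u t)) (fun t => L (v t)) := by
  intro η h1 h2 h3
  have e := congrArg L (h η h1 h2 h3)
  rw [map_neg, ← ContinuousLinearMap.integral_comp_comm L
    (IntegrableOn.continuous_smul_of_hasCompactSupport hu (h1.continuous_deriv (by simp)) h2.deriv),
    ← ContinuousLinearMap.integral_comp_comm L
    (IntegrableOn.continuous_smul_of_hasCompactSupport hv h1.continuous h2)] at e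
  simpa using e

/-- A continuous function with a continuous weak derivative is continuously differentiable. -/
lemma HasWeakTimeDeriv.hasDerivWithinAt [CompleteSpace X] {T : ℝ} (hT : 0 < T) {u v : ℝ → X}
    (h : HasWeakTimeDeriv T u v) (hu : ContinuousOn u (Icc 0 T)) (hv : ContinuousOn v (Icc 0 T))
    {t : ℝ} (ht : t ∈ Icc 0 T) : HasDerivWithinAt u (v t) (Icc 0 T) t := by
  obtain ⟨w, hc, he⟩ := exists_continuous_eqOn_Icc hT.le hv
  have hd : ∀ t, HasDerivAt (fun t => ∫ s in (0 : ℝ)..t, w s) (w t) t := fun t =>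
    intervalIntegral.integral_hasDerivAt_right (hc.intervalIntegrable _ _)
      (hc.stronglyMeasurableAtFilter _ _) hc.continuousAt
  have hWc : Continuous (fun t => ∫ s in (0 : ℝ)..t, w s) :=
    continuous_iff_continuousAt.2 fun t => (hd t).continuousAt
  have hui : IntegrableOn u (Ioo 0 T) := hu.integrableOn_Icc.mono_set Ioo_subset_Icc_self
  have hWi : IntegrableOn (fun t => ∫ s in (0 : ℝ)..t, w s) (Ioo 0 T) :=
    hWc.continuousOn.integrableOn_Icc.mono_set Ioo_subset_Icc_self
  -- The difference of u and a primitive of v has zero weak derivative, by integration by parts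
  -- against η, whose boundary terms vanish.
  obtain ⟨c, hcst⟩ := ae_eq_const_of_integral_deriv_smul_eq_zero hT
    (h := fun t => u t - ∫ s in (0 : ℝ)..t, w s) (hui.sub hWi) (by
      intro η h1 h2 h3
      have hη' := h1.continuous_deriv (by simp)
      have hη0 : η 0 = 0 := image_eq_zero_of_notMem_tsupport fun h => (lt_irrefl _ (h3 h).1)
      have hηT : η T = 0 := image_eq_zero_of_notMem_tsupport fun h => (lt_irrefl _ (h3 h).2)
      have parts := intervalIntegral.integral_smul_deriv_eq_deriv_smul (a := 0) (b := T)
        (u := η) (v := fun t => ∫ s in (0 : ℝ)..t, w s)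
        (fun x _ => (h1.differentiable (by simp) x).hasDerivAt) (fun x _ => hd x)
        (hη'.intervalIntegrable _ _) (hc.intervalIntegrable _ _)
      rw [hη0, hηT, zero_smul, zero_smul, sub_zero, zero_sub,
        intervalIntegral.integral_of_le hT.le, intervalIntegral.integral_of_le hT.le,
        integral_Ioc_eq_integral_Ioo, integral_Ioc_eq_integral_Ioo] at parts
      simp only [smul_sub]
      rw [integral_sub (IntegrableOn.continuous_smul_of_hasCompactSupport hui hη' h2.deriv)
        (IntegrableOn.continuous_smul_of_hasCompactSupport hWi hη' h2.deriv), h η h1 h2 h3,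
        ← neg_eq_iff_eq_neg.2 parts, sub_eq_zero]
      congr 1
      exact setIntegral_congr_fun measurableSet_Ioo fun s hs => by
        simp only [he (Ioo_subset_Icc_self hs)])
  -- Continuity upgrades "almost everywhere" to the open interval, and density then reaches the
  -- endpoints.
  have hIcc : ∀ t ∈ Icc 0 T, u t - ∫ s in (0 : ℝ)..t, w s = c := by
    have h1 : EqOn (fun t => u t - ∫ s in (0 : ℝ)..t, w s) (fun _ => c) (Ioo 0 T) :=
      Measure.eqOn_open_of_ae_eq hcst isOpen_Ioo
        ((hu.mono Ioo_subset_Icc_self).sub hWc.continuousOn) continuousOn_const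
    have h2 := h1.of_subset_closure (hu.sub hWc.continuousOn) continuousOn_const
      Ioo_subset_Icc_self (by rw [closure_Ioo hT.ne])
    exact fun t ht => h2 ht
  have := ((hd t).const_add c).hasDerivWithinAt (s := Icc 0 T)
  rw [he ht] at this
  exact this.congr (fun s hs => by rw [← hIcc s hs]; abel) (by rw [← hIcc t ht]; abel)

end WeakTimeDeriv

/-! ### The wave equation in a pair of Hilbert spaces -/

section Abstract

variable {V H : Type*} [NormedAddCommGroup V] [InnerProductSpace ℝ V] [CompleteSpace V]
  [NormedAddCommGroup H] [InnerProductSpace ℝ H] [CompleteSpace H]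

open scoped RealInnerProductSpace

/-- The operator `i* i` on `V` for an embedding `i : V → H`. -/
def gram (i : V →L[ℝ] H) : V →L[ℝ] V := i.adjoint ∘L i

lemma inner_gram_left (i : V →L[ℝ] H) (x y : V) : ⟪gram i x, y⟫ = ⟪i x, i y⟫ := by
  rw [gram, ContinuousLinearMap.comp_apply, ContinuousLinearMap.adjoint_inner_left]

lemma inner_gram_right (i : V →L[ℝ] H) (x y : V) : ⟪x, gram i y⟫ = ⟪i x, i y⟫ := by
  rw [gram, ContinuousLinearMap.comp_apply, ContinuousLinearMap.adjoint_inner_right]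

lemma gram_injective {i : V →L[ℝ] H} (hi : Function.Injective i) :
    Function.Injective (gram i) := by
  refine (injective_iff_map_eq_zero _).2 fun x hx => hi ?_
  have h := inner_gram_left i x x
  rw [hx, inner_zero_left] at h
  rw [map_zero, inner_self_eq_zero.1 h.symm]

/-- The orthogonal complement of the range of a self-adjoint operator is its kernel, here trivial.
-/
lemma denseRange_gram {i : V →L[ℝ] H} (hi : Function.Injective i) : DenseRange (gram i) := by
  have h : (gram i).rangeᗮ = ⊥ := by
    refine (Submodule.eq_bot_iff _).2 fun x hx => gram_injective hi ?_
    refine ext_inner_right ℝ fun y => ?_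
    rw [map_zero, inner_zero_left, inner_gram_left, ← inner_gram_right]
    exact real_inner_comm x _ ▸ hx _ ⟨y, rfl⟩
  have h2 := Submodule.topologicalClosure_eq_top_iff.2 h
  intro x
  have : x ∈ (gram i).range.topologicalClosure := by rw [h2]; trivial
  exact this

/-! ### Approximate inverses of i* i by resolvents -/

/-- The resolvent of `gram i` at `-ε`. -/
lemma exists_resolvent (i : V →L[ℝ] H) {ε : ℝ} (hε : 0 < ε) :
    ∃ R : V →L[ℝ] V, (∀ x, gram i (R x) + ε • R x = x) ∧ (∀ x, R (gram i x + ε • x) = x) := by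
  -- G is nonnegative, so G + ε is coercive with constant ε and Lax–Milgram inverts it.
  have hco : IsCoercive ((innerSL ℝ : V →L[ℝ] V →L[ℝ] ℝ) ∘L
      (gram i + ε • ContinuousLinearMap.id ℝ V)) := by
    refine ⟨ε, hε, fun u => ?_⟩
    have : ⟪gram i u + ε • u, u⟫ = ‖i u‖ ^ 2 + ε * (‖u‖ * ‖u‖) := by
      rw [inner_add_left, inner_gram_left, real_inner_smul_left, real_inner_self_eq_norm_sq,
        real_inner_self_eq_norm_mul_norm]
    change ε * ‖u‖ * ‖u‖ ≤ ⟪gram i u + ε • u, u⟫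
    rw [this]
    nlinarith [sq_nonneg ‖i u‖]
  have he : ∀ x, hco.continuousLinearEquivOfBilin x = gram i x + ε • x := fun x =>
    ext_inner_right ℝ fun y => by
      rw [hco.continuousLinearEquivOfBilin_apply]
      rfl
  refine ⟨hco.continuousLinearEquivOfBilin.symm, fun x => ?_, fun x => ?_⟩
  · rw [← he]
    exact hco.continuousLinearEquivOfBilin.apply_symm_apply x
  · rw [← he]
    exact hco.continuousLinearEquivOfBilin.symm_apply_apply x

/-- Since R G x - x = -ε R x, it suffices to pair (G + ε) R x = x with R x and drop the nonnegative
term ‖i R x‖². The bound does not depend on ε, which makes the density argument for strong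
convergence work. -/
lemma norm_resolvent_gram_sub_le {i : V →L[ℝ] H} {ε : ℝ} (hε : 0 < ε) {R : V →L[ℝ] V}
    (hR : ∀ x, gram i (R x) + ε • R x = x) (hR' : ∀ x, R (gram i x + ε • x) = x) (x : V) :
    ‖R (gram i x) - x‖ ≤ ‖x‖ := by
  have h1 : R (gram i x) - x = -(ε • R x) := by
    have := hR' x
    rw [map_add, map_smul] at this
    rw [← eq_sub_iff_add_eq] at this
    rw [this]; abel
  rw [h1, norm_neg, norm_smul, Real.norm_of_nonneg hε.le]
  by_cases h0 : R x = 0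
  · rw [h0, norm_zero, mul_zero]; exact norm_nonneg _
  have h2 : ε * ‖R x‖ ^ 2 ≤ ‖x‖ * ‖R x‖ := by
    refine le_trans ?_ (real_inner_le_norm x (R x))
    have : ⟪x, R x⟫ = ‖i (R x)‖ ^ 2 + ε * ‖R x‖ ^ 2 := by
      have h : ⟪gram i (R x) + ε • R x, R x⟫ = ‖i (R x)‖ ^ 2 + ε * ‖R x‖ ^ 2 := by
        rw [inner_add_left, inner_gram_left, real_inner_smul_left, real_inner_self_eq_norm_sq,
          real_inner_self_eq_norm_sq]
      rwa [hR] at h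
    rw [this]
    nlinarith [sq_nonneg ‖i (R x)‖]
  have h3 : 0 < ‖R x‖ := norm_pos_iff.2 h0
  exact le_of_mul_le_mul_right (by linarith [h2, sq (‖R x‖), mul_assoc ε ‖R x‖ ‖R x‖]) h3

/-- Bounded operators `L n`, commuting with `gram i`, that converge strongly to the inverse of
`(gram i)²`. -/
lemma exists_tendsto_gram_gram {i : V →L[ℝ] H} (hi : Function.Injective i) :
    ∃ L : ℕ → V →L[ℝ] V, (∀ n x, L n (gram i x) = gram i (L n x)) ∧
      ∀ x, Tendsto (fun n => L n (gram i (gram i x))) atTop (𝓝 x) := by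
  choose R hR hR' using fun n : ℕ => exists_resolvent i (ε := 1 / ((n : ℝ) + 1)) (by positivity)
  have hcomm : ∀ n x, R n (gram i x) = gram i (R n x) := by
    intro n x
    have h1 := hR n x
    have h2 := hR' n x
    rw [map_add, map_smul] at h2
    exact add_right_cancel (h2.trans h1.symm)
  have hJ : ∀ n x, ‖R n (gram i x) - x‖ ≤ ‖x‖ := fun n x =>
    norm_resolvent_gram_sub_le (by positivity) (hR n) (hR' n) x
  have hlim : ∀ x, Tendsto (fun n => R n (gram i x)) atTop (𝓝 x) := by
    intro x
    rw [Metric.tendsto_atTop]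
    intro δ hδ
    -- On the range of G the error is ε R G z, of norm at most 2ε‖z‖; the remainder x - G z is
    -- handled by the uniform bound.
    obtain ⟨z, hz⟩ := (denseRange_gram hi).exists_dist_lt x (half_pos hδ)
    have hz' : ‖x - gram i z‖ < δ / 2 := by rwa [← dist_eq_norm]
    have hsm : Tendsto (fun n : ℕ => 1 / ((n : ℝ) + 1) * (2 * ‖z‖)) atTop (𝓝 (0 * (2 * ‖z‖))) :=
      tendsto_one_div_add_atTop_nhds_zero_nat.mul_const _
    rw [zero_mul] at hsm
    obtain ⟨N, hN⟩ := eventually_atTop.1 (hsm.eventually_lt_const (half_pos hδ))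
    refine ⟨N, fun n hn => ?_⟩
    have h1 : R n (gram i (gram i z)) - gram i z = -((1 / ((n : ℝ) + 1)) • R n (gram i z)) := by
      have := hR' n (gram i z)
      rw [map_add, map_smul, ← eq_sub_iff_add_eq] at this
      rw [this]; abel
    have h2 : ‖R n (gram i (gram i z)) - gram i z‖ ≤ 1 / ((n : ℝ) + 1) * (2 * ‖z‖) := by
      rw [h1, norm_neg, norm_smul, Real.norm_of_nonneg (by positivity)]
      refine mul_le_mul_of_nonneg_left ?_ (by positivity)
      have := norm_sub_norm_le (R n (gram i z)) z
      linarith [hJ n z]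
    have h3 : R n (gram i x) - x = (R n (gram i (x - gram i z)) - (x - gram i z)) +
        (R n (gram i (gram i z)) - gram i z) := by
      simp only [map_sub]; abel
    rw [dist_eq_norm, h3]
    refine (norm_add_le _ _).trans_lt ?_
    linarith [hJ n (x - gram i z), hN n hn]
  refine ⟨fun n => R n ∘L R n, fun n x => ?_, fun x => ?_⟩
  · simp only [ContinuousLinearMap.comp_apply, hcomm]
  · rw [tendsto_iff_norm_sub_tendsto_zero]
    have h0 : Tendsto (fun n => 3 * ‖R n (gram i x) - x‖) atTop (𝓝 0) := by
      simpa using (tendsto_iff_norm_sub_tendsto_zero.1 (hlim x)).const_mul 3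
    refine squeeze_zero (fun _ => norm_nonneg _) (fun n => ?_) h0
    -- With J = R G, J²x - x is split as (J - 1)(Jx - x) + 2(Jx - x); the bound ‖(J - 1)y‖ ≤ ‖y‖
    -- gives the factor 3.
    have h1 : (R n ∘L R n) (gram i (gram i x)) - x =
        (R n (gram i (R n (gram i x) - x)) - (R n (gram i x) - x)) +
          (R n (gram i x) - x) + (R n (gram i x) - x) := by
      simp only [ContinuousLinearMap.comp_apply, hcomm, map_sub]; abel
    rw [h1]
    refine (norm_add₃_le).trans ?_
    linarith [hJ n (R n (gram i x) - x)]

/-! ### Energy identity and Gronwall estimate for regularised trajectories -/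

section Regularised

variable {i : V →L[ℝ] H} {T : ℝ} {p q : ℝ → V}
  {L : V →L[ℝ] V}

lemma hasDerivWithinAt_regularised_left {t : ℝ}
    (hp : HasDerivWithinAt p (q t) (Icc 0 T) t) :
    HasDerivWithinAt (fun s => L (gram i (p s))) (L (gram i (q t))) (Icc 0 T) t :=
  (L ∘L gram i).hasFDerivAt.comp_hasDerivWithinAt t hp

lemma hasDerivWithinAt_regularised_right {t : ℝ}
    (hq : HasDerivWithinAt (fun s => gram i (q s)) (gram i (p t) - p t) (Icc 0 T) t) :
    HasDerivWithinAt (fun s => L (gram i (q s))) (L (gram i (p t) - p t)) (Icc 0 T) t :=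
  L.hasFDerivAt.comp_hasDerivWithinAt t hq

/-- This is the equation tested with the regularised velocity: moving i to the other side produces a
factor G, which commutes with L and supplies the second G needed to recognise the V-inner product.
-/
lemma inner_regularised_eq (hL : ∀ x, L (gram i x) = gram i (L x)) (x y : V) :
    ⟪i (L (gram i y)), i (L (gram i x - x))⟫ =
      ⟪i (L (gram i x)), i (L (gram i y))⟫ - ⟪L (gram i x), L (gram i y)⟫ := by
  rw [← inner_gram_right, ← hL, map_sub, map_sub, inner_sub_right, hL (gram i x),
    inner_gram_right, real_inner_comm, real_inner_comm (L (gram i x))]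

/-- Conservation of energy for regularised solutions. -/
lemma regularised_energy_eq (hL : ∀ x, L (gram i x) = gram i (L x))
    (hp : ∀ t ∈ Icc 0 T, HasDerivWithinAt p (q t) (Icc 0 T) t)
    (hq : ∀ t ∈ Icc 0 T,
      HasDerivWithinAt (fun s => gram i (q s)) (gram i (p t) - p t) (Icc 0 T) t)
    {t : ℝ} (ht : t ∈ Icc 0 T) :
    ‖L (gram i (p t))‖ ^ 2 - ‖i (L (gram i (p t)))‖ ^ 2 + ‖i (L (gram i (q t)))‖ ^ 2 =
    ‖L (gram i (p 0))‖ ^ 2 - ‖i (L (gram i (p 0)))‖ ^ 2 + ‖i (L (gram i (q 0)))‖ ^ 2 := by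
  have hd : ∀ t ∈ Icc 0 T, HasDerivWithinAt (fun t => ‖L (gram i (p t))‖ ^ 2 -
      ‖i (L (gram i (p t)))‖ ^ 2 + ‖i (L (gram i (q t)))‖ ^ 2) 0 (Icc 0 T) t := by
    intro t ht
    have h1 := hasDerivWithinAt_regularised_left (i := i) (L := L) (hp t ht)
    have h2 := hasDerivWithinAt_regularised_right (L := L) (hq t ht)
    have h3 := i.hasFDerivAt.comp_hasDerivWithinAt t h1
    have h4 := i.hasFDerivAt.comp_hasDerivWithinAt t h2
    refine ((h1.norm_sq.sub h3.norm_sq).add h4.norm_sq).congr_deriv ?_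
    simp only [Function.comp_apply]
    rw [inner_regularised_eq hL]
    ring
  refine constant_of_has_deriv_right_zero (fun t ht => (hd t ht).continuousWithinAt) ?_ t ht
  intro s hs
  exact (hd s (Ico_subset_Icc_self hs)).mono_of_mem_nhdsWithin (Icc_mem_nhdsGE_of_mem hs)

/-- The conserved quantity ‖u‖² - ‖i u‖² + ‖v‖² need not control ‖u‖ without a Poincaré inequality.
The full norm has derivative 2⟪v, i u⟫, bounded by the norm squared itself, so Gronwall applies. -/
lemma regularised_norm_le (hL : ∀ x, L (gram i x) = gram i (L x)) (hi1 : ∀ x, ‖i x‖ ≤ ‖x‖)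
    (hp : ∀ t ∈ Icc 0 T, HasDerivWithinAt p (q t) (Icc 0 T) t)
    (hq : ∀ t ∈ Icc 0 T,
      HasDerivWithinAt (fun s => gram i (q s)) (gram i (p t) - p t) (Icc 0 T) t)
    {t : ℝ} (ht : t ∈ Icc 0 T) :
    ‖L (gram i (p t))‖ ^ 2 + ‖i (L (gram i (q t)))‖ ^ 2 ≤
      Real.exp T * (‖L (gram i (p 0))‖ ^ 2 + ‖i (L (gram i (q 0)))‖ ^ 2) := by
  set F : ℝ → ℝ := fun t => ‖L (gram i (p t))‖ ^ 2 + ‖i (L (gram i (q t)))‖ ^ 2 with hF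
  have hd : ∀ t ∈ Icc 0 T, HasDerivWithinAt F
      (2 * ⟪i (L (gram i (q t))), i (L (gram i (p t)))⟫) (Icc 0 T) t := by
    intro t ht
    have h1 := hasDerivWithinAt_regularised_left (i := i) (L := L) (hp t ht)
    have h2 := hasDerivWithinAt_regularised_right (L := L) (hq t ht)
    have h4 := i.hasFDerivAt.comp_hasDerivWithinAt t h2
    refine (h1.norm_sq.add h4.norm_sq).congr_deriv ?_
    simp only [Function.comp_apply]
    rw [inner_regularised_eq hL, real_inner_comm (i (L (gram i (q t))))]
    ring
  have hle : ∀ t, 2 * ⟪i (L (gram i (q t))), i (L (gram i (p t)))⟫ ≤ F t := by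
    intro t
    have h1 := real_inner_le_norm (i (L (gram i (q t)))) (i (L (gram i (p t))))
    have h2 := hi1 (L (gram i (p t)))
    have h3 : ‖i (L (gram i (p t)))‖ ^ 2 ≤ ‖L (gram i (p t))‖ ^ 2 := by gcongr
    simp only [hF]
    nlinarith [sq_nonneg (‖i (L (gram i (q t)))‖ - ‖i (L (gram i (p t)))‖)]
  have hE : ∀ t ∈ Icc 0 T, HasDerivWithinAt (fun t => Real.exp (-t) * F t)
      (Real.exp (-t) * (-1) * F t +
        Real.exp (-t) * (2 * ⟪i (L (gram i (q t))), i (L (gram i (p t)))⟫)) (Icc 0 T) t :=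
    fun t ht => ((hasDerivAt_neg t).exp.hasDerivWithinAt).mul (hd t ht)
  have hanti : AntitoneOn (fun t => Real.exp (-t) * F t) (Icc 0 T) := by
    refine antitoneOn_of_hasDerivWithinAt_nonpos (convex_Icc 0 T)
      (fun t ht => (hE t ht).continuousWithinAt)
      (fun t ht => (hE t (interior_subset ht)).mono interior_subset) fun t _ => ?_
    nlinarith [hle t, Real.exp_pos (-t)]
  have h0 := hanti ⟨le_rfl, ht.1.trans ht.2⟩ ht ht.1
  simp only [neg_zero, Real.exp_zero, one_mul] at h0
  have h1 : F t = Real.exp t * (Real.exp (-t) * F t) := by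
    rw [← mul_assoc, ← Real.exp_add, add_neg_cancel, Real.exp_zero, one_mul]
  have hF0 : 0 ≤ F 0 := by positivity
  change F t ≤ Real.exp T * F 0
  rw [h1]
  exact mul_le_mul (Real.exp_le_exp.2 ht.2) h0
    (mul_nonneg (Real.exp_pos _).le (by positivity)) (Real.exp_pos _).le

end Regularised

end Abstract

/-! ### Passage to the limit and reduction of weak solutions to the first-order system -/

section AbstractSolution

open scoped RealInnerProductSpace

lemma exists_tendstoUniformlyOn_of_sq_norm_sub_le {X Y Z S : Type*} [NormedAddCommGroup X]
    [CompleteSpace X] [NormedAddCommGroup Y] [NormedAddCommGroup Z] {f : ℕ → S → X} {s : Set S}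
    {a : ℕ → Y} {b : ℕ → Z} (ha : CauchySeq a) (hb : CauchySeq b) (C : ℝ)
    (h : ∀ n m, ∀ x ∈ s, ‖f n x - f m x‖ ^ 2 ≤ C * (‖a n - a m‖ ^ 2 + ‖b n - b m‖ ^ 2)) :
    ∃ F : S → X, TendstoUniformlyOn f F atTop s := by
  have hu : UniformCauchySeqOn f atTop s := by
    rw [Metric.uniformCauchySeqOn_iff]
    intro ε hε
    have h0 : Tendsto (fun n : ℕ × ℕ => C * (dist (a n.1) (a n.2) ^ 2 + dist (b n.1) (b n.2) ^ 2))
        atTop (𝓝 (C * (0 ^ 2 + 0 ^ 2))) :=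
      (((cauchySeq_iff_tendsto_dist_atTop_0.1 ha).pow 2).add
        ((cauchySeq_iff_tendsto_dist_atTop_0.1 hb).pow 2)).const_mul C
    rw [show C * (0 ^ 2 + 0 ^ 2 : ℝ) = 0 by ring] at h0
    obtain ⟨N, hN⟩ := eventually_atTop.1 (h0.eventually_lt_const (pow_pos hε 2))
    refine ⟨max N.1 N.2, fun m hm n hn x hx => ?_⟩
    have h1 := hN (m, n) ⟨(le_max_left _ _).trans hm, (le_max_right _ _).trans hn⟩
    have h2 := h m n x hx
    simp only [dist_eq_norm] at h1 ⊢
    exact lt_of_pow_lt_pow_left₀ 2 hε.le (h2.trans_lt h1)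
  have hex : ∀ x, ∃ y, x ∈ s → Tendsto (fun n => f n x) atTop (𝓝 y) := fun x => by
    by_cases hx : x ∈ s
    · obtain ⟨y, hy⟩ := cauchySeq_tendsto_of_complete (hu.cauchySeq hx)
      exact ⟨y, fun _ => hy⟩
    · exact ⟨0, fun h => (hx h).elim⟩
  choose F hF using hex
  exact ⟨F, hu.tendstoUniformlyOn_of_tendsto hF⟩

variable {V H : Type*} [NormedAddCommGroup V] [InnerProductSpace ℝ V] [CompleteSpace V]
  [NormedAddCommGroup H] [InnerProductSpace ℝ H] [CompleteSpace H]

/-- If `p = i* i Φ` and `q = i* Ψ` solve the wave equation in the weak space, then `Φ` and `Ψ` are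
continuous with values in the energy spaces, and the energy is conserved. -/
theorem exists_energy_solution {i : V →L[ℝ] H} (hi : Function.Injective i)
    (hi1 : ∀ x, ‖i x‖ ≤ ‖x‖) {T : ℝ} (hT : 0 ≤ T) {p q : ℝ → V} {x₀ x₁ : V}
    (hp0 : p 0 = gram i x₀) (hq0 : q 0 = gram i x₁)
    (hp : ∀ t ∈ Icc 0 T, HasDerivWithinAt p (q t) (Icc 0 T) t)
    (hq : ∀ t ∈ Icc 0 T,
      HasDerivWithinAt (fun s => gram i (q s)) (gram i (p t) - p t) (Icc 0 T) t) :
    ∃ (Φ : ℝ → V) (Ψ : ℝ → H), ContinuousOn Φ (Icc 0 T) ∧ ContinuousOn Ψ (Icc 0 T) ∧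
      (∀ t ∈ Icc 0 T, gram i (Φ t) = p t) ∧
      (∀ t ∈ Icc 0 T, HasDerivWithinAt (fun s => i (Φ s)) (Ψ t) (Icc 0 T) t) ∧
      Φ 0 = x₀ ∧ Ψ 0 = i x₁ ∧
      ∀ t ∈ Icc 0 T, ‖Φ t‖ ^ 2 - ‖i (Φ t)‖ ^ 2 + ‖Ψ t‖ ^ 2 =
        ‖Φ 0‖ ^ 2 - ‖i (Φ 0)‖ ^ 2 + ‖Ψ 0‖ ^ 2 := by
  have h0T : (0 : ℝ) ∈ Icc 0 T := ⟨le_rfl, hT⟩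
  obtain ⟨L, hL, hlim⟩ := exists_tendsto_gram_gram hi
  set u : ℕ → ℝ → V := fun n t => L n (gram i (p t)) with hu
  set v : ℕ → ℝ → H := fun n t => i (L n (gram i (q t))) with hv
  have hu0 : Tendsto (fun n => u n 0) atTop (𝓝 x₀) := by
    simpa only [hu, hp0] using hlim x₀
  have hv0 : Tendsto (fun n => v n 0) atTop (𝓝 (i x₁)) := by
    simpa only [hv, hq0, Function.comp_def] using (i.continuous.tendsto _).comp (hlim x₁)
  have hbound : ∀ n m, ∀ t ∈ Icc 0 T, ‖u n t - u m t‖ ^ 2 + ‖v n t - v m t‖ ^ 2 ≤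
      Real.exp T * (‖u n 0 - u m 0‖ ^ 2 + ‖v n 0 - v m 0‖ ^ 2) := by
    intro n m t ht
    -- The difference of two regularising operators also commutes with G, so the Gronwall bound
    -- compares two approximations directly.
    have := regularised_norm_le (i := i) (L := L n - L m) (fun x => by
      simp only [sub_apply, map_sub, hL]) hi1 hp hq ht
    simpa only [sub_apply, map_sub] using this
  obtain ⟨Φ, hΦ⟩ := exists_tendstoUniformlyOn_of_sq_norm_sub_le (f := u) (s := Icc 0 T)
    hu0.cauchySeq hv0.cauchySeq (Real.exp T) fun n m t ht =>
      le_trans (le_add_of_nonneg_right (sq_nonneg _)) (hbound n m t ht)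
  obtain ⟨Ψ, hΨ⟩ := exists_tendstoUniformlyOn_of_sq_norm_sub_le (f := v) (s := Icc 0 T)
    hu0.cauchySeq hv0.cauchySeq (Real.exp T) fun n m t ht =>
      le_trans (le_add_of_nonneg_left (sq_nonneg _)) (hbound n m t ht)
  have hud : ∀ n, ∀ t ∈ Icc 0 T,
      HasDerivWithinAt (fun s => i (u n s)) (v n t) (Icc 0 T) t := fun n t ht =>
    i.hasFDerivAt.comp_hasDerivWithinAt t (hasDerivWithinAt_regularised_left (hp t ht))
  have huc : ∀ n, ContinuousOn (u n) (Icc 0 T) := fun n t ht =>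
    (hasDerivWithinAt_regularised_left (hp t ht)).continuousWithinAt
  have hvc : ∀ n, ContinuousOn (v n) (Icc 0 T) := fun n t ht =>
    (i.hasFDerivAt.comp_hasDerivWithinAt t
      (hasDerivWithinAt_regularised_right (hq t ht))).continuousWithinAt
  have hΦc := hΦ.continuousOn (Eventually.of_forall huc).frequently
  have hΨc := hΨ.continuousOn (Eventually.of_forall hvc).frequently
  have hΦ0 : Φ 0 = x₀ := tendsto_nhds_unique (hΦ.tendsto_at h0T) hu0
  have hΨ0 : Ψ 0 = i x₁ := tendsto_nhds_unique (hΨ.tendsto_at h0T) hv0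
  have hiΦ : ∀ t ∈ Icc 0 T, Tendsto (fun n => i (u n t)) atTop (𝓝 (i (Φ t))) := fun t ht =>
    (i.continuous.tendsto _).comp (hΦ.tendsto_at ht)
  refine ⟨Φ, Ψ, hΦc, hΨc, fun t ht => ?_, fun t ht => ?_, hΦ0, hΨ0, fun t ht => ?_⟩
  -- G u_n = L_n G² p tends both to GΦ and to p.
  · refine tendsto_nhds_unique (((gram i).continuous.tendsto _).comp (hΦ.tendsto_at ht)) ?_
    refine (hlim (p t)).congr fun n => ?_
    simp only [Function.comp_apply, hu, hL]
  · refine hasDerivWithinAt_of_eq_add_integral hΨc (fun t ht => ?_) ht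
    have hsub : uIcc 0 t ⊆ Icc 0 T := by
      rw [uIcc_of_le ht.1]
      exact Icc_subset_Icc_right ht.2
    have hint : ∀ n, i (u n t) = i (u n 0) + ∫ s in (0 : ℝ)..t, v n s := by
      intro n
      rw [intervalIntegral.integral_eq_sub_of_hasDeriv_right_of_le ht.1
        (f := fun s => i (u n s)) (i.continuous.comp_continuousOn
          ((huc n).mono (Icc_subset_Icc_right ht.2)))
        (fun s hs => (hud n s ⟨hs.1.le, hs.2.le.trans ht.2⟩).mono_of_mem_nhdsWithin
          (Icc_mem_nhdsGT_of_mem ⟨hs.1.le, hs.2.trans_le ht.2⟩))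
        ((hvc n).mono hsub).intervalIntegrable]
      abel
    refine tendsto_nhds_unique (hiΦ t ht) ?_
    simp only [hint]
    exact (hiΦ 0 h0T).add (TendstoUniformlyOn.tendsto_intervalIntegral_of_continuousOn
      (Eventually.of_forall fun n => (hvc n).mono hsub) (hΨ.mono hsub))
  · have hE : ∀ t ∈ Icc 0 T, Tendsto
        (fun n => ‖u n t‖ ^ 2 - ‖i (u n t)‖ ^ 2 + ‖v n t‖ ^ 2) atTop
        (𝓝 (‖Φ t‖ ^ 2 - ‖i (Φ t)‖ ^ 2 + ‖Ψ t‖ ^ 2)) := fun t ht =>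
      (((hΦ.tendsto_at ht).norm.pow 2).sub ((hiΦ t ht).norm.pow 2)).add
        ((hΨ.tendsto_at ht).norm.pow 2)
    refine tendsto_nhds_unique (hE t ht) ((hE 0 h0T).congr fun n => ?_)
    exact (regularised_energy_eq (hL n) hp hq ht).symm

/-- The Riesz isomorphism, as a real-linear map. -/
def riesz (V : Type*) [NormedAddCommGroup V] [InnerProductSpace ℝ V] [CompleteSpace V] :
    StrongDual ℝ V →L[ℝ] V :=
  LinearMap.mkContinuous
    { toFun := fun l => (InnerProductSpace.toDual ℝ V).symm l
      map_add' := fun l m => map_add _ l m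
      map_smul' := fun a l => by simp } 1 fun l => by simp

lemma inner_riesz (l : StrongDual ℝ V) (w : V) : ⟪riesz V l, w⟫ = l w :=
  InnerProductSpace.toDual_symm_apply

/-- Under the Riesz map the pivot embedding of H into the dual of V becomes i*, so dual-valued
statements turn into statements in V. -/
lemma riesz_pivot (i : V →L[ℝ] H) (g : H) :
    riesz V ((innerSL ℝ g).comp i) = i.adjoint g := by
  refine ext_inner_right ℝ fun w => ?_
  rw [inner_riesz, ContinuousLinearMap.adjoint_inner_left]
  rfl

/-- Weak solutions of the abstract wave equation with data in the energy space are continuous with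
values in the energy space, and conserve energy. -/
theorem exists_energy_solution_of_weak {i : V →L[ℝ] H} (hi : Function.Injective i)
    (hi1 : ∀ x, ‖i x‖ ≤ ‖x‖) {T : ℝ} (hT : 0 < T) {x₀ x₁ : V} {φ : ℝ → V} {φt : ℝ → H}
    {φtt : ℝ → StrongDual ℝ V}
    (hφ : MemLp φ 2 (volume.restrict (Ioo 0 T))) (hφt : MemLp φt 2 (volume.restrict (Ioo 0 T)))
    (hφtt : MemLp φtt 2 (volume.restrict (Ioo 0 T)))
    (h1 : HasWeakTimeDeriv T (fun t => i (φ t)) φt)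
    (h2 : HasWeakTimeDeriv T (fun t => (innerSL ℝ (φt t)).comp i) φtt)
    (heq : ∀ w : V, ∀ᵐ t ∂(volume.restrict (Ioo 0 T)),
      φtt t w + (⟪φ t, w⟫ - ⟪i (φ t), i w⟫) = 0)
    (hini : HasInitialValue T (fun t => i (φ t)) (i x₀))
    (hini' : HasInitialValue T (fun t => (innerSL ℝ (φt t)).comp i)
      ((innerSL ℝ (i x₁)).comp i)) :
    ∃ (Φ : ℝ → V) (Ψ : ℝ → H), ContinuousOn Φ (Icc 0 T) ∧ ContinuousOn Ψ (Icc 0 T) ∧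
      Φ =ᵐ[volume.restrict (Ioo 0 T)] φ ∧
      (∀ t ∈ Icc 0 T, HasDerivWithinAt (fun s => i (Φ s)) (Ψ t) (Icc 0 T) t) ∧
      Φ 0 = x₀ ∧ Ψ 0 = i x₁ ∧
      ∀ t ∈ Icc 0 T, ‖Φ t‖ ^ 2 - ‖i (Φ t)‖ ^ 2 + ‖Ψ t‖ ^ 2 =
        ‖Φ 0‖ ^ 2 - ‖i (Φ 0)‖ ^ 2 + ‖Ψ 0‖ ^ 2 := by
  replace hφ : IntegrableOn φ (Ioo 0 T) := hφ.integrable (by norm_num)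
  replace hφt : IntegrableOn φt (Ioo 0 T) := hφt.integrable (by norm_num)
  replace hφtt : IntegrableOn φtt (Ioo 0 T) := hφtt.integrable (by norm_num)
  obtain ⟨c, hcc, hc, hc0⟩ := hini
  obtain ⟨d, hdc, hd, hd0⟩ := hini'
  have hpc : ContinuousOn (fun t => i.adjoint (c t)) (Icc 0 T) :=
    i.adjoint.continuous.comp_continuousOn hcc
  have hqc : ContinuousOn (fun t => riesz V (d t)) (Icc 0 T) :=
    (riesz V).continuous.comp_continuousOn hdc
  have hpφ : ∀ᵐ t ∂(volume.restrict (Ioo 0 T)), i.adjoint (c t) = gram i (φ t) :=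
    hc.mono fun t ht => by rw [ht]; rfl
  have hqφ : ∀ᵐ t ∂(volume.restrict (Ioo 0 T)), riesz V (d t) = i.adjoint (φt t) :=
    hd.mono fun t ht => by rw [ht, riesz_pivot]
  have hp : HasWeakTimeDeriv T (fun t => i.adjoint (c t)) (fun t => riesz V (d t)) :=
    (h1.map (i.integrable_comp hφ) hφt i.adjoint).congr hpφ hqφ
  have hq : HasWeakTimeDeriv T (fun t => gram i (riesz V (d t)))
      (fun t => gram i (i.adjoint (c t)) - i.adjoint (c t)) := by
    have hd_int : IntegrableOn d (Ioo 0 T) := hdc.integrableOn_Icc.mono_set Ioo_subset_Icc_self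
    have h3 := (h2.congr hd (ae_eq_refl φtt)).map hd_int hφtt (gram i ∘L riesz V)
    intro η hη hηc hηs
    refine (h3 η hη hηc hηs).trans (congrArg Neg.neg ?_)
    have hI1 : IntegrableOn (fun t => η t • (gram i ∘L riesz V) (φtt t)) (Ioo 0 T) :=
      IntegrableOn.continuous_smul_of_hasCompactSupport
        ((gram i ∘L riesz V).integrable_comp hφtt) hη.continuous hηc
    have hI2 : IntegrableOn (fun t => η t • (gram i (i.adjoint (c t)) - i.adjoint (c t)))
        (Ioo 0 T) :=
      IntegrableOn.continuous_smul_of_hasCompactSupport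
        ((((gram i).continuous.comp_continuousOn hpc).sub hpc).integrableOn_Icc.mono_set
          Ioo_subset_Icc_self) hη.continuous hηc
    -- The null set in the weak equation depends on the test vector, so the integrals are compared
    -- against one fixed w at a time. Self-adjointness of G moves it onto w, making G w the test
    -- vector.
    refine ext_inner_left ℝ fun w => ?_
    rw [← integral_inner hI1, ← integral_inner hI2]
    refine integral_congr_ae ?_
    filter_upwards [heq (gram i w), hpφ] with t ht htp
    have e : ⟪i (φ t), i (gram i w)⟫ = ⟪i w, i (gram i (φ t))⟫ := by
      rw [← inner_gram_left, inner_gram_right, real_inner_comm]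
    rw [real_inner_smul_right, real_inner_smul_right, htp, ContinuousLinearMap.comp_apply,
      inner_gram_right, ← inner_gram_left, real_inner_comm, inner_riesz,
      eq_neg_of_add_eq_zero_left ht, inner_sub_right, inner_gram_right, inner_gram_right,
      inner_gram_right, e, real_inner_comm (i w), neg_sub]
  obtain ⟨Φ, Ψ, hΦ, hΨ, hgram, hder, hΦ0, hΨ0, hE⟩ := exists_energy_solution hi hi1 hT.le
    (x₀ := x₀) (x₁ := x₁) (p := fun t => i.adjoint (c t)) (q := fun t => riesz V (d t))
    (by rw [hc0]; rfl) (by rw [hd0, riesz_pivot]; rfl)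
    (fun t ht => hp.hasDerivWithinAt hT hpc hqc ht)
    (fun t ht => hq.hasDerivWithinAt hT ((gram i).continuous.comp_continuousOn hqc)
      (((gram i).continuous.comp_continuousOn hpc).sub hpc) ht)
  refine ⟨Φ, Ψ, hΦ, hΨ, ?_, hder, hΦ0, hΨ0, hE⟩
  filter_upwards [hpφ, ae_restrict_mem measurableSet_Ioo] with t ht htm
  exact gram_injective hi ((hgram t (Ioo_subset_Icc_self htm)).trans ht)

end AbstractSolution

/-! ### Test functions determine functions on the cylinder -/

/-- The coordinate map from the plane to the cylinder. -/
def proj (p : ℝ × ℝ) : Cyl := ((p.1 : AddCircle (2 * Real.pi)), p.2)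

/-- Transfers integrals over Ω to an open coordinate rectangle; the omitted seam is a null set. -/
lemma measurePreserving_proj :
    MeasurePreserving proj (volume.restrict (Ioo 0 (2 * Real.pi) ×ˢ Ioo (0 : ℝ) 1)) muOmega := by
  have h1 := AddCircle.measurePreserving_mk (2 * Real.pi) 0
  rw [zero_add, ← Measure.restrict_congr_set Ioo_ae_eq_Ioc] at h1
  have h2 := h1.prod (MeasurePreserving.id (volume.restrict (Ioo (0 : ℝ) 1)))
  have e : muOmega = (volume : Measure (AddCircle (2 * Real.pi))).prod
      (volume.restrict (Ioo (0 : ℝ) 1)) := by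
    rw [muOmega, Omega, Measure.volume_eq_prod, ← Measure.prod_restrict, Measure.restrict_univ]
  rw [e, Measure.volume_eq_prod, ← Measure.prod_restrict]
  exact h2

/-- A test function on the coordinate rectangle extends periodically to a test function on the
cylinder. -/
lemma exists_isTest_comp_proj {η : ℝ × ℝ → ℝ} (hη : ContDiff ℝ ∞ η) (hηc : HasCompactSupport η)
    (hηs : tsupport η ⊆ Ioo 0 (2 * Real.pi) ×ˢ Ioo (0 : ℝ) 1) :
    ∃ ψ, IsTest ψ ∧ ∀ x ∈ Ioo 0 (2 * Real.pi) ×ˢ Ioo (0 : ℝ) 1, ψ (proj x) = η x := by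
  have hpi := Real.two_pi_pos
  set ψ : Cyl → ℝ := fun z => η (AddCircle.equivIoc (2 * Real.pi) 0 z.1, z.2) with hψ
  have hψproj : ∀ x : ℝ × ℝ, ψ (proj x) = η (toIocMod hpi 0 x.1, x.2) := fun x => rfl
  have hmem : ∀ x r, η (x, r) ≠ 0 → x ∈ Prod.fst '' tsupport η := fun x r h =>
    ⟨(x, r), subset_tsupport _ h, rfl⟩
  obtain ⟨a, b, ha, hab0, hb, hab⟩ := exists_Icc_of_isCompact_subset_Ioo hpi
    (hηc.isCompact.image continuous_fst) (image_subset_iff.2 fun x hx => (hηs hx).1)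
  have hzero : ∀ x r, x ∉ Icc a b → η (x, r) = 0 := fun x r hx => by
    by_contra h
    exact hx (hab (hmem x r h))
  -- Reduction modulo 2π jumps at the seam, but the angular support lies in [a, b] with 0 < a and b
  -- < 2π. On this window, which contains (0, 2π], the reduced and unreduced angles either coincide
  -- or both lie outside [a, b].
  have hloc : ∀ (k : ℤ) (x r : ℝ), x - k • (2 * Real.pi) ∈ Ioo (b - 2 * Real.pi) (2 * Real.pi + a) →
      η (toIocMod hpi 0 x, r) = η (x - k • (2 * Real.pi), r) := by
    intro k x r hx
    rw [← toIocMod_sub_zsmul hpi 0 x k]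
    set y := x - k • (2 * Real.pi)
    rcases le_or_gt y 0 with h0 | h0
    · have e : toIocMod hpi 0 y = y + 2 * Real.pi :=
        (toIocMod_eq_iff hpi).2 ⟨⟨by linarith [hx.1, hab0], by linarith⟩, -1, by simp⟩
      rw [e, hzero _ r fun h => by linarith [h.2, hx.1], hzero _ r fun h => by linarith [h.1]]
    rcases le_or_gt y (2 * Real.pi) with h1 | h1
    · rw [(toIocMod_eq_self hpi).2 ⟨h0, by linarith⟩]
    · have e : toIocMod hpi 0 y = y - 2 * Real.pi :=
        (toIocMod_eq_iff hpi).2 ⟨⟨by linarith, by linarith [hx.2, hab0]⟩, 1, by simp⟩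
      rw [e, hzero _ r fun h => by linarith [h.1, hx.2], hzero _ r fun h => by linarith [h.2]]
  have hK : IsCompact (proj '' tsupport η) :=
    hηc.isCompact.image isOpenQuotientMap_proj.continuous
  have hsupp : tsupport ψ ⊆ proj '' tsupport η := by
    refine closure_minimal (fun z hz => ⟨_, subset_tsupport _ hz, ?_⟩) hK.isClosed
    exact Prod.ext ((AddCircle.equivIoc (2 * Real.pi) 0).symm_apply_apply z.1) rfl
  refine ⟨ψ, ⟨?_, hK.of_isClosed_subset (isClosed_tsupport _) hsupp, fun z hz => ?_⟩, ?_⟩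
  · refine contDiff_iff_contDiffAt.2 fun x₀ => ?_
    set k := toIocDiv hpi 0 x₀.1
    have hx₀ : x₀.1 - k • (2 * Real.pi) ∈ Ioo (b - 2 * Real.pi) (2 * Real.pi + a) := by
      have := sub_toIocDiv_zsmul_mem_Ioc hpi 0 x₀.1
      exact ⟨by linarith [this.1], by linarith [this.2]⟩
    have hcd : ContDiffAt ℝ ∞ (fun x : ℝ × ℝ => η (x.1 - k • (2 * Real.pi), x.2)) x₀ :=
      (hη.comp ((contDiff_fst.sub contDiff_const).prodMk contDiff_snd)).contDiffAt
    refine hcd.congr_of_eventuallyEq ?_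
    have hc : ContinuousAt (fun x : ℝ × ℝ => x.1 - k • (2 * Real.pi)) x₀ := by fun_prop
    filter_upwards [hc.eventually (isOpen_Ioo.mem_nhds hx₀)] with x hx
    exact hloc k x.1 x.2 hx
  · obtain ⟨x, hx, rfl⟩ := hsupp hz
    exact ⟨mem_univ _, (hηs hx).2⟩
  · intro x hx
    rw [hψproj, (toIocMod_eq_self hpi).2 ⟨hx.1.1, by linarith [hx.1.2]⟩]

/-- The fundamental lemma of the calculus of variations on `Ω`, with a power weight. -/
lemma eq_zero_of_integral_rpow_mul_test (u : L2) (β : ℝ)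
    (h : ∀ ψ, IsTest ψ → ∫ z, (z.2 ^ β * u z) * ψ z ∂muOmega = 0) : u = 0 := by
  have hopen : IsOpen (Ioo 0 (2 * Real.pi) ×ˢ Ioo (0 : ℝ) 1) := isOpen_Ioo.prod isOpen_Ioo
  obtain ⟨f, hfu, hf⟩ : ∃ f : Cyl → ℝ, f = u ∧ Measurable f :=
    ⟨u, rfl, (Lp.stronglyMeasurable u).measurable⟩
  rw [← hfu] at h
  have hu : IntegrableOn (fun x => f (proj x)) (Ioo 0 (2 * Real.pi) ×ˢ Ioo (0 : ℝ) 1) :=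
    measurePreserving_proj.integrable_comp_of_integrable
      (hfu ▸ (Lp.memLp u).integrable (by norm_num))
  have key := hopen.ae_eq_zero_of_integral_contDiff_smul_eq_zero (μ := volume)
    (f := fun x => x.2 ^ β * f (proj x))
    (hu.locallyIntegrableOn.continuousOn_mul (continuousOn_snd.rpow_const fun z hz =>
      Or.inl hz.2.1.ne') hopen.isLocallyClosed) ?_
  · have h0 : ∀ᵐ z ∂muOmega, f z = 0 := by
      rw [← measurePreserving_proj.map_eq, ae_map_iff measurePreserving_proj.aemeasurable
        (measurableSet_eq_fun hf measurable_const),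
        ae_restrict_iff' hopen.measurableSet]
      filter_upwards [key] with x hx hxm
      exact (mul_eq_zero.1 (hx hxm)).resolve_left (Real.rpow_pos_of_pos hxm.2.1 β).ne'
    exact Lp.eq_zero_iff_ae_eq_zero.2 (hfu ▸ h0)
  intro η hη hηc hηs
  obtain ⟨ψ, hψ, hψη⟩ := exists_isTest_comp_proj hη hηc hηs
  have h1 := h ψ hψ
  rw [← measurePreserving_proj.map_eq, integral_map measurePreserving_proj.aemeasurable] at h1
  · rw [← setIntegral_eq_integral_of_forall_compl_eq_zero
      (s := Ioo 0 (2 * Real.pi) ×ˢ Ioo (0 : ℝ) 1)]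
    · refine Eq.trans ?_ h1
      refine setIntegral_congr_fun hopen.measurableSet fun x hx => ?_
      simp only [hψη x hx, smul_eq_mul]
      exact mul_comm _ _
    · intro x hx
      simp only [image_eq_zero_of_notMem_tsupport fun h => hx (hηs h), zero_smul]
  · exact (((measurable_snd.pow_const β).mul hf).mul
      hψ.smooth.continuous.measurable).aestronglyMeasurable

/-! ### The weighted spaces -/

/-- A function determines its weak gradient: if u = 0, both gradient components integrate to zero
against every test function. The weight r^{-α/2} is harmless because it is positive on Ω. -/
lemma toL2_injective (α : ℝ) : Function.Injective (toL2 α) := by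
  refine (injective_iff_map_eq_zero _).2 fun U hU => ?_
  have hgrad : IsWeakGrad (fnOf U) (gradTheta U) (gradRad α U) := U.1.2
  have hfn : fnOf (U : Ambient) = 0 := hU
  have h0 : fnOf (U : Ambient) =ᵐ[muOmega] fun _ => 0 := by
    rw [hfn]; exact Lp.coeFn_zero _ _ _
  have h1 : (U : Ambient).snd.fst = 0 := by
    refine eq_zero_of_integral_rpow_mul_test _ 0 fun ψ hψ => ?_
    have := hgrad.theta ψ hψ
    rw [integral_zero_mul h0, eq_comm, neg_eq_zero] at this
    simpa [gradTheta] using this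
  have h2 : (U : Ambient).snd.snd = 0 := by
    refine eq_zero_of_integral_rpow_mul_test _ (-(α / 2)) fun ψ hψ => ?_
    have := hgrad.rad ψ hψ
    rwa [integral_zero_mul h0, eq_comm, neg_eq_zero] at this
  refine Subtype.ext (Subtype.ext ?_)
  exact WithLp.ofLp_injective 2 (Prod.ext hfn (WithLp.ofLp_injective 2 (Prod.ext h1 h2)))

lemma continuous_integral_mul {g : Cyl → ℝ} (hg : MemLp g 2 muOmega) :
    Continuous fun u : L2 => ∫ z, u z * g z ∂muOmega := by
  have h : (fun u : L2 => ∫ z, u z * g z ∂muOmega) = fun u => inner ℝ (hg.toLp g) u := by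
    funext u
    rw [L2.inner_def]
    refine integral_congr_ae ?_
    filter_upwards [hg.coeFn_toLp] with z hz
    rw [hz]
    rfl
  rw [h]
  fun_prop

lemma memLp_of_continuous {g : Cyl → ℝ} (hg : Continuous g) : MemLp g 2 muOmega := by
  have hK : IsCompact ((univ : Set (AddCircle (2 * Real.pi))) ×ˢ Icc (0 : ℝ) 1) :=
    isCompact_univ.prod isCompact_Icc
  obtain ⟨C, hC⟩ := hK.exists_bound_of_continuousOn hg.continuousOn
  refine MemLp.of_bound hg.aestronglyMeasurable C ?_
  exact (ae_restrict_iff' measurableSet_Omega).2 (Eventually.of_forall fun z hz =>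
    hC z ⟨mem_univ _, Ioo_subset_Icc_self hz.2⟩)

lemma memLp_rpow_mul_test (β : ℝ) {ψ : Cyl → ℝ} (hψ : IsTest ψ) :
    MemLp (fun z : Cyl => z.2 ^ β * ψ z) 2 muOmega := by
  have hcont : ContinuousOn (fun z : Cyl => z.2 ^ β * ψ z) (tsupport ψ) :=
    (continuousOn_snd.rpow_const fun z hz => Or.inl (hψ.support hz).2.1.ne').mul
      hψ.smooth.continuous.continuousOn
  obtain ⟨C, hC⟩ := IsCompact.exists_bound_of_continuousOn hψ.compact hcont
  refine MemLp.of_bound ((measurable_snd.pow_const β).mul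
    hψ.smooth.continuous.measurable).aestronglyMeasurable (max C 0)
    (Eventually.of_forall fun z => ?_)
  by_cases hz : z ∈ tsupport ψ
  · exact (hC z hz).trans (le_max_left _ _)
  · simp [image_eq_zero_of_notMem_tsupport hz]

/-- Each test function imposes two equations between continuous functionals of the triple. The
singular weight is moved onto the test function, whose support stays away from r = 0, so the product
is square integrable. -/
lemma isClosed_H1 (α : ℝ) : IsClosed (H1 α : Set Ambient) := by
  have hset : (H1 α : Set Ambient) = ⋂ (ψ) (_ : IsTest ψ),
      {U : Ambient | ∫ z, U.fst z * dTheta ψ z ∂muOmega = -∫ z, U.snd.fst z * ψ z ∂muOmega} ∩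
      {U : Ambient | ∫ z, U.fst z * dRad ψ z ∂muOmega =
        -∫ z, U.snd.snd z * (z.2 ^ (-(α / 2)) * ψ z) ∂muOmega} := by
    have e : ∀ (U : Ambient) (ψ : Cyl → ℝ), ∫ z, gradRad α U z * ψ z ∂muOmega =
        ∫ z, U.snd.snd z * (z.2 ^ (-(α / 2)) * ψ z) ∂muOmega := fun U ψ =>
      integral_congr_ae (Eventually.of_forall fun z => by simp only [gradRad]; ring)
    ext U
    simp only [mem_iInter, mem_inter_iff, mem_ofPred_eq, ← e]
    exact ⟨fun h ψ hψ => ⟨h.theta ψ hψ, h.rad ψ hψ⟩,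
      fun h => ⟨fun ψ hψ => (h ψ hψ).1, fun ψ hψ => (h ψ hψ).2⟩⟩
  rw [hset]
  have c1 : Continuous fun U : Ambient => U.fst := (WithLp.fstL 2 ℝ L2 _).continuous
  have c2 : Continuous fun U : Ambient => U.snd := (WithLp.sndL 2 ℝ L2 _).continuous
  have c3 : Continuous fun U : Ambient => U.snd.fst := (WithLp.fstL 2 ℝ L2 L2).continuous.comp c2
  have c4 : Continuous fun U : Ambient => U.snd.snd := (WithLp.sndL 2 ℝ L2 L2).continuous.comp c2
  refine isClosed_iInter fun ψ => isClosed_iInter fun hψ => IsClosed.inter ?_ ?_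
  · exact isClosed_eq
      ((continuous_integral_mul (memLp_of_continuous hψ.smooth.continuous_dTheta)).comp c1)
      ((continuous_integral_mul (memLp_of_continuous hψ.smooth.continuous)).comp c3).neg
  · exact isClosed_eq
      ((continuous_integral_mul (memLp_of_continuous hψ.smooth.continuous_dRad)).comp c1)
      ((continuous_integral_mul (memLp_rpow_mul_test _ hψ)).comp c4).neg

instance completeSpace_H1 (α : ℝ) : CompleteSpace (H1 α) :=
  (isClosed_H1 α).completeSpace_coe

instance completeSpace_H1Gamma (α : ℝ) : CompleteSpace (H1Gamma α) :=
  (smoothGamma α).isClosed_topologicalClosure.completeSpace_coe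

instance innerProductSpace_H1 (α : ℝ) : @InnerProductSpace ℝ (H1 α) _
    (H1 α).normedAddCommGroup.toSeminormedAddCommGroup :=
  Submodule.innerProductSpace (𝕜 := ℝ) (E := Ambient) (H1 α)

instance innerProductSpace_H1Gamma (α : ℝ) : InnerProductSpace ℝ (H1Gamma α) :=
  @Submodule.innerProductSpace ℝ (H1 α) _ _ (innerProductSpace_H1 α) (H1Gamma α)

/-! ### The gradient form and the energy in terms of Hilbert norms -/

lemma gradDot_ae_eq (α : ℝ) (U V : Ambient) :
    gradDot α U V =ᵐ[muOmega] fun z =>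
      inner ℝ (U.snd.fst z) (V.snd.fst z) + inner ℝ (U.snd.snd z) (V.snd.snd z) := by
  filter_upwards [ae_restrict_mem measurableSet_Omega] with z hz
  have hz0 : 0 < z.2 := hz.2.1
  -- The two factors r^{-α/2} that recover ∂_r from the stored component cancel the weight r^α.
  have e : z.2 ^ α * (z.2 ^ (-(α / 2)) * z.2 ^ (-(α / 2))) = 1 := by
    rw [← Real.rpow_add hz0, ← Real.rpow_add hz0]
    ring_nf
    exact Real.rpow_zero _
  simp only [gradDot, gradTheta, gradRad, RCLike.inner_apply, conj_trivial]
  linear_combination (U.snd.snd z * V.snd.snd z) * e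

lemma integrable_gradDot (α : ℝ) (U V : Ambient) : Integrable (gradDot α U V) muOmega :=
  ((L2.integrable_inner U.snd.fst V.snd.fst).add (L2.integrable_inner U.snd.snd V.snd.snd)).congr
    (gradDot_ae_eq α U V).symm

lemma gradForm_eq (α : ℝ) (u v : H1Gamma α) :
    gradForm α u v = inner ℝ u v - inner ℝ (toL2 α u) (toL2 α v) := by
  have h : inner ℝ u v = inner ℝ (toL2 α u) (toL2 α v) +
      (inner ℝ (u : Ambient).snd.fst (v : Ambient).snd.fst +
        inner ℝ (u : Ambient).snd.snd (v : Ambient).snd.snd) := rfl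
  rw [h, add_sub_cancel_left, gradForm, integral_congr_ae (gradDot_ae_eq α u v),
    integral_add (L2.integrable_inner _ _) (L2.integrable_inner _ _), L2.inner_def, L2.inner_def]

lemma energy_eq (α : ℝ) (u : H1Gamma α) (v : L2) :
    energy α u v = 1 / 2 * (‖u‖ ^ 2 - ‖toL2 α u‖ ^ 2 + ‖v‖ ^ 2) := by
  have h : ∫ z, (v z) ^ 2 ∂muOmega = ‖v‖ ^ 2 := by
    rw [← real_inner_self_eq_norm_sq, L2.inner_def]
    refine integral_congr_ae (Eventually.of_forall fun z => ?_)
    simp only [real_inner_self_eq_norm_sq, Real.norm_eq_abs, sq_abs]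
  have hv : Integrable (fun z => (v z) ^ 2) muOmega := (Lp.memLp v).integrable_sq
  rw [energy, integral_add hv (integrable_gradDot α u u), h]
  change 1 / 2 * (‖v‖ ^ 2 + gradForm α u u) = _
  rw [gradForm_eq, real_inner_self_eq_norm_sq, real_inner_self_eq_norm_sq]
  ring

lemma norm_toL2_le (α : ℝ) (u : H1Gamma α) : ‖toL2 α u‖ ≤ ‖u‖ := by
  have h := gradForm_eq α u u
  have h0 : 0 ≤ gradForm α u u := by
    rw [gradForm, integral_congr_ae (gradDot_ae_eq α u u)]
    exact integral_nonneg fun z => add_nonneg real_inner_self_nonneg real_inner_self_nonneg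
  rw [real_inner_self_eq_norm_sq, real_inner_self_eq_norm_sq] at h
  exact le_of_sq_le_sq (by linarith) (norm_nonneg _)

end DegenerateWave

end

theorem corollary2p30 (α T : ℝ) (hα : α ∈ Set.Ico (1 : ℝ) 2) (hT : 0 < T)
    (φ₀ φ₁ : DegenerateWave.H1Gamma α) (hφ₀ : DegenerateWave.InDomain α φ₀)
    (φ : ℝ → DegenerateWave.H1Gamma α)
    (hφ : DegenerateWave.IsWeakSolution α T φ₀ (DegenerateWave.toL2 α φ₁) (fun _ => 0) φ) :
    ∃ (Φ : ℝ → DegenerateWave.H1Gamma α) (Ψ : ℝ → DegenerateWave.L2),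
      ContinuousOn Φ (Set.Icc 0 T) ∧ ContinuousOn Ψ (Set.Icc 0 T) ∧
      Φ =ᵐ[volume.restrict (Set.Ioo 0 T)] φ ∧
      (∀ t ∈ Set.Icc 0 T,
        HasDerivWithinAt (fun s => DegenerateWave.toL2 α (Φ s)) (Ψ t) (Set.Icc 0 T) t) ∧
      Φ 0 = φ₀ ∧ Ψ 0 = DegenerateWave.toL2 α φ₁ ∧
      ∀ t ∈ Set.Icc 0 T,
        DegenerateWave.energy α (Φ t) (Ψ t) = DegenerateWave.energy α (Φ 0) (Ψ 0) := by
  obtain ⟨hφ2, φt, φtt, hφt2, hφtt2, h1, h2, heq, hini, hini'⟩ := hφ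
  have key := DegenerateWave.exists_energy_solution_of_weak (V := DegenerateWave.H1Gamma α)
    (H := DegenerateWave.L2) (i := DegenerateWave.toL2 α) (T := T) (x₀ := φ₀) (x₁ := φ₁) (φ := φ)
    (φt := φt) (φtt := φtt)
  obtain ⟨Φ, Ψ, hΦ, hΨ, hae, hder, hΦ0, hΨ0, hE⟩ := key (DegenerateWave.toL2_injective α)
    (DegenerateWave.norm_toL2_le α) hT hφ2 hφt2 hφtt2 h1 h2
    -- The gradient form is the full inner product minus the L² part, so the abstract equation is
    -- the given one with f = 0.
    (fun w => (heq w).mono fun t ht => by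
      rw [← DegenerateWave.gradForm_eq, ht, inner_zero_left]) hini hini'
  refine ⟨Φ, Ψ, hΦ, hΨ, hae, hder, hΦ0, hΨ0, fun t ht => ?_⟩
  rw [DegenerateWave.energy_eq, DegenerateWave.energy_eq, hE t ht]
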